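/- **Setting.** Let $n,m\ge 1$, $d\ge 0$. Agent $j\in\{1,\dots,n\}$ holds $m$ sample losses $\ell_{j,1},\dots,\ell_{j,m}:\mathbb R^d\to\mathbb R$; put $f_j=\frac1m\sum_i \ell_{j,i}$ and $f=\frac1n\sum_j f_j$. Let $\boldsymbol W=[w_{ij}]\in\mathbb R^{n\times n}$ be a mixing matrix of an undirected graph on the agents: $w_{ij}=0$ if $i\ne j$ are not adjacent, all row and column sums are $1$, and $\alpha_0:=\|\boldsymbol W-\frac1n\boldsymbol 1\boldsymbol 1^\top\|<1$ (spectral norm). Assume that every $\ell_{j,i}$ is convex and $L$-smooth, that every $f_j$ is twice differentiable with $\sigma I\preceq\nabla^2 f_j(x)\preceq LI$ for all $x$, where $0<\sigma\le L$, and that $\beta/\sigma\le 1/200$, where $\beta:=\max_j\sup_x\|\nabla^2f_j(x)-\nabla^2 f(x)\|$. Let $\kappa=L/\sigma$ and let $y^{\mathsf{opt}}$ be the minimizer of $f$. **Algorithms** (parameters: $K$ mixing rounds, step size $\delta$, $S$ inner steps). From initial points $x_j^{(0)}$, set $y_j^{(0)}=x_j^{(0)}$ and $s_j^{(0)}=\nabla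 f_j(y_j^{(0)})$. In iteration $t\ge1$ the agents perform $K$ communication rounds, in each of which both their parameter and their gradient estimates are replaced by the $\boldsymbol W$-weighted averages over the neighbours, starting from $x_j^{(t-1)}$ and $s_j^{(t-1)}$; so, with the stacked vectors, $y^{(t)}=(\boldsymbol W^K\otimes I_d)\,x^{(t-1)}$ and $s^{(t)}=(\boldsymbol W^K\otimes I_d)\,s^{(t-1)}+[\nabla f_j(y_j^{(t)})-\nabla f_j(y_j^{(t-1)})]_{j}$. Then each agent sets $u^0=y_j^{(t)}$, $v^0=s_j^{(t)}$ and for $k=1,\dots,S$ takes $u^k=u^{k-1}-\delta v^{k-1}$, samples $i$ uniformly from $\{1,\dots,m\}$, and sets $v^k=\nabla\ell_{j,i}(u^k)-\nabla\ell_{j,i}(u^0)+v^0$ (Network-SVRG) or $v^k=\nabla\ell_{j,i}(u^k)-\nabla\ell_{j,i}(u^{k-1})+v^{k-1}$ (Network-SARAH); $x_j^{(t)}$ is chosen uniformly from $\{u^1,\dots,u^S\}$. All random choices are independent. **Error.** With $\overline y^{(t)}=\frac1n\sum_j y_j^{(t)}$ let $$e_t=\max\Big\{\sqrt n\,\|\overline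 y^{(t)}-y^{\mathsf{opt}}\|_2,\ \big\|[y_j^{(t)}-\overline y^{(t)}]_j\big\|_2,\ L^{-1}\big\|[s_j^{(t)}-\nabla f(y_j^{(t)})]_j\big\|_2\Big\}.$$ **Theorem.** There are absolute constants $\rho,c\in(0,1)$ and $\eta,c_S,A>0$, and for every $c_1>0$ a constant $B>0$ depending only on $c_1$, such that the following holds in the above setting. Consider Network-SVRG, or, if in addition every $f_j$ is quadratic, $f_j(x)=\frac12x^\top H_jx+b_j^\top x+c_j$ with $H_j$ symmetric positive semidefinite, Network-SARAH. Let $\delta=\eta/L$, let $K\ge1$ satisfy $\alpha_0^K\le c/\kappa$, let $S\ge c_S\kappa$, and let the initial points be arbitrary. 1. The algorithm converges linearly in expectation: each $e_t$ is integrable and there is a constant $C>0$, not depending on $t$, with $\mathbb E[e_t]\le C\rho^t$ for all $t\ge1$. 2. For all sufficiently small $\varepsilon>0$ there is $T\le A\log(1/\varepsilon)$ with $\mathbb E[e_t]\le\varepsilon$ for all $t\ge T$. If moreover $K$ is not excessively large, in the sense that $\alpha_0^{K-1}\ge c_1/\kappa$ (in particular if $\alpha_0^K\ge c_1/\kappa$),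 then the first $T$ iterations use at most $$B\cdot(1+\log\kappa)\cdot\frac{\log(1/\varepsilon)}{1-\alpha_0}$$ communication rounds. If $c_1\le c$, then there is $K\ge1$ with $\alpha_0^K\le c/\kappa$ and $\alpha_0^{K-1}\ge c_1/\kappa$. -/

import Mathlib

open MeasureTheory ProbabilityTheory

noncomputable section

namespace NetVR

/-- The parameter space `ℝ^d` with its Euclidean norm. -/
abbrev Vec (d : ℕ) : Type := EuclideanSpace ℝ (Fin d)

/-! ### Loss functions

`loss j i : ℝ^d → ℝ` is the sample loss of the `i`-th of the `m` samples held by agent `j`. -/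

/-- The local loss `f_j = (1/m) ∑_i loss j i`. -/
def localLoss {n m d : ℕ} (loss : Fin n → Fin m → Vec d → ℝ) (j : Fin n) (x : Vec d) : ℝ :=
  (m : ℝ)⁻¹ * ∑ i, loss j i x

/-- The global loss `f = (1/n) ∑_j f_j`. -/
def globalLoss {n m d : ℕ} (loss : Fin n → Fin m → Vec d → ℝ) (x : Vec d) : ℝ :=
  (n : ℝ)⁻¹ * ∑ j, localLoss loss j x

/-- The Hessian `∇²f(x)`, as a linear operator: the derivative of the gradient. -/
def hessian {d : ℕ} (f : Vec d → ℝ) (x : Vec d) : Vec d →L[ℝ] Vec d :=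
  fderiv ℝ (gradient f) x

/-- `g` is convex and `L`-smooth (differentiable with `L`-Lipschitz gradient). -/
structure IsConvexSmooth {d : ℕ} (L : ℝ) (g : Vec d → ℝ) : Prop where
  convex : ConvexOn ℝ Set.univ g
  differentiable : Differentiable ℝ g
  lipschitz : ∀ x y, ‖gradient g x - gradient g y‖ ≤ L * ‖x - y‖

/-- `g` is twice differentiable and `σ I ⪯ ∇²g(x) ⪯ L I` for every `x`. -/
structure IsStronglyConvexSmooth {d : ℕ} (σ L : ℝ) (g : Vec d → ℝ) : Prop where
  differentiable : Differentiable ℝ g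
  differentiable_gradient : Differentiable ℝ (gradient g)
  lower : ∀ x v, σ * ‖v‖ ^ 2 ≤ inner ℝ (hessian g x v) v
  upper : ∀ x v, inner ℝ (hessian g x v) v ≤ L * ‖v‖ ^ 2

/-- `g` is a quadratic function `(1/2) xᵀ H x + bᵀ x + c` with `H` symmetric and positive
semidefinite. -/
def IsQuadratic {d : ℕ} (g : Vec d → ℝ) : Prop :=
  ∃ (H : Vec d →L[ℝ] Vec d) (b : Vec d) (c : ℝ), H.IsPositive ∧
    ∀ x, g x = (1 / 2) * inner ℝ (H x) x + inner ℝ b x + c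

/-- The homogeneity parameter `β = max_j sup_x ‖∇²f_j(x) - ∇²f(x)‖` (operator norm). -/
def homogeneity {n m d : ℕ} (loss : Fin n → Fin m → Vec d → ℝ) : ℝ :=
  ⨆ j : Fin n, ⨆ x : Vec d, ‖hessian (localLoss loss j) x - hessian (globalLoss loss) x‖

/-! ### The network -/

/-- The mixing rate `α₀ = ‖W - (1/n) 1 1ᵀ‖` (spectral norm). -/
def mixingRate {n : ℕ} (W : Matrix (Fin n) (Fin n) ℝ) : ℝ :=
  ‖Matrix.toEuclideanCLM (n := Fin n) (𝕜 := ℝ) (W - Matrix.of fun _ _ => (n : ℝ)⁻¹)‖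

/-- `W` is a mixing matrix for the undirected graph `G`: off-diagonal entries vanish outside the
edges of `G`, all row and column sums are `1`, and the mixing rate is smaller than `1`. -/
structure IsMixingMatrix {n : ℕ} (G : SimpleGraph (Fin n)) (W : Matrix (Fin n) (Fin n) ℝ) :
    Prop where
  support : ∀ i j, i ≠ j → ¬ G.Adj i j → W i j = 0
  row_sum : ∀ i, ∑ j, W i j = 1
  col_sum : ∀ j, ∑ i, W i j = 1
  rate_lt_one : mixingRate W < 1

/-- Neighbourly averaging, `(mix W q)_j = ∑_i w_{ji} q_i`. Since `W` is supported on the edges and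
the diagonal, only agent `j` and its neighbours contribute. -/
def mix {n d : ℕ} (W : Matrix (Fin n) (Fin n) ℝ) (q : Fin n → Vec d) : Fin n → Vec d :=
  fun j => ∑ i, W j i • q i

/-- What the agents hold while they mix: parameter estimates, gradient estimates, and a counter of
the communication rounds performed so far. -/
structure Message (n d : ℕ) where
  y : Fin n → Vec d
  s : Fin n → Vec d
  rounds : ℕ

/-- One communication round: each agent receives the two estimates of its neighbours and replaces
its own by the weighted averages. -/
def Message.exchange {n d : ℕ} (W : Matrix (Fin n) (Fin n) ℝ) (q : Message n d) : Message n d where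
  y := mix W q.y
  s := mix W q.s
  rounds := q.rounds + 1

/-! ### The algorithms -/

/-- The two variance-reduced local solvers. -/
inductive Variant
  | svrg
  | sarah

/-- The stochastic direction `v^s`, for a sampled loss `g`: here `y = u^0`, `s = v^0` are the inputs
of the inner loop, `u = u^{s-1}`, `v = v^{s-1}` the previous inner iterate and direction, and
`u' = u^s` the current inner iterate. -/
def direction {d : ℕ} (alg : Variant) (g : Vec d → ℝ) (y s u v u' : Vec d) : Vec d :=
  match alg with
  | .svrg => gradient g u' - gradient g y + s
  | .sarah => gradient g u' - gradient g u + v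

/-- The inner loop of one agent with sample losses `g`, step size `δ`, inputs `y`, `s` and sampled
indices `z`: entry `k` is the pair `(u^k, v^k)`, for `k = 0, …, S`. -/
def innerLoop {m d S : ℕ} (alg : Variant) (g : Fin m → Vec d → ℝ) (δ : ℝ) (y s : Vec d)
    (z : Fin S → Fin m) : Fin (S + 1) → Vec d × Vec d :=
  Fin.induction (motive := fun _ => Vec d × Vec d) (y, s) fun k uv =>
    let u' := uv.1 - δ • uv.2
    (u', direction alg (g (z k)) y s uv.1 uv.2 u')

/-- The randomness that one agent uses in one iteration: the `S` sampled indices, and the index `r`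
(counted from `0`) for which `u^{r+1}`, among `u^1, …, u^S`, becomes the new parameter estimate. -/
abbrev Seed (m S : ℕ) : Type := (Fin S → Fin m) × Fin S

/-- The state after an iteration: all `x_j`, `y_j`, `s_j`, and the number of communication rounds
performed so far. -/
structure State (n d : ℕ) where
  x : Fin n → Vec d
  y : Fin n → Vec d
  s : Fin n → Vec d
  rounds : ℕ

/-- Initialization: `y_j = x_j` and `s_j = ∇f_j(y_j)`. -/
def initialState {n m d : ℕ} (loss : Fin n → Fin m → Vec d → ℝ) (x₀ : Fin n → Vec d) :
    State n d where
  x := x₀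
  y := x₀
  s := fun j => gradient (localLoss loss j) (x₀ j)
  rounds := 0

/-- One iteration: `K` communication rounds, gradient tracking, and the inner loops. -/
def iterate {n m d S : ℕ} (alg : Variant) (loss : Fin n → Fin m → Vec d → ℝ)
    (W : Matrix (Fin n) (Fin n) ℝ) (K : ℕ) (δ : ℝ) (seed : Fin n → Seed m S) (st : State n d) :
    State n d :=
  let q := (Message.exchange W)^[K] ⟨st.x, st.s, st.rounds⟩
  let s' : Fin n → Vec d := fun j =>
    q.s j + gradient (localLoss loss j) (q.y j) - gradient (localLoss loss j) (st.y j)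
  { x := fun j => (innerLoop alg (loss j) δ (q.y j) (s' j) (seed j).1 (seed j).2.succ).1
    y := q.y
    s := s'
    rounds := q.rounds }

/-- The state of Network-SVRG (or Network-SARAH) after `t` iterations; iteration `t + 1` uses the
seeds `seed (t, j)`. -/
def run {n m d S : ℕ} (alg : Variant) (loss : Fin n → Fin m → Vec d → ℝ)
    (W : Matrix (Fin n) (Fin n) ℝ) (K : ℕ) (δ : ℝ) (x₀ : Fin n → Vec d)
    (seed : ℕ × Fin n → Seed m S) : ℕ → State n d
  | 0 => initialState loss x₀
  | t + 1 => iterate alg loss W K δ (fun j => seed (t, j)) (run alg loss W K δ x₀ seed t)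

/-- All random choices of the algorithm are independent and uniform: the seeds of different
(iteration, agent) pairs are independent, and each is uniform on the finite set
`(Fin S → Fin m) × Fin S`, that is, its `S` samples are independent and uniform on the local data
set, and the index of the new estimate is uniform and independent of them. -/
structure IsUniformSampling {n m S : ℕ} {Ω : Type*} [MeasurableSpace Ω] (P : Measure Ω)
    (seed : ℕ × Fin n → Ω → Seed m S) : Prop where
  measurable : ∀ p, Measurable (seed p)
  uniform : ∀ p a, P.real {ω | seed p ω = a} = ((m : ℝ) ^ S * S)⁻¹
  indep : iIndepFun seed P

/-! ### The error metric -/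

/-- The average `(1/n) ∑_j q_j`. -/
def average {n d : ℕ} (q : Fin n → Vec d) : Vec d := (n : ℝ)⁻¹ • ∑ j, q j

/-- `max {√n ‖ȳ - y_opt‖, ‖y - 1 ⊗ ȳ‖, L⁻¹ ‖s - ∇f(y)‖}`, the last two being norms of stacked
vectors in `ℝ^{nd}`, with `∇f(y) = [∇f(y_1), …, ∇f(y_n)]`. -/
def errorMetric {n m d : ℕ} (loss : Fin n → Fin m → Vec d → ℝ) (L : ℝ) (yopt : Vec d)
    (st : State n d) : ℝ :=
  max (√(n : ℝ) * ‖average st.y - yopt‖)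
    (max √(∑ j, ‖st.y j - average st.y‖ ^ 2)
      (L⁻¹ * √(∑ j, ‖st.s j - gradient (globalLoss loss) (st.y j)‖ ^ 2)))

/-- The random error metric after `t` iterations. -/
def errorAt {n m d S : ℕ} (alg : Variant) (loss : Fin n → Fin m → Vec d → ℝ)
    (W : Matrix (Fin n) (Fin n) ℝ) (K : ℕ) (δ L : ℝ) (yopt : Vec d) (x₀ : Fin n → Vec d)
    {Ω : Type*} (seed : ℕ × Fin n → Ω → Seed m S) (t : ℕ) (ω : Ω) : ℝ :=
  errorMetric loss L yopt (run alg loss W K δ x₀ (fun p => seed p ω) t)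

end NetVR

end

/-! Agent `j`'s inner loop is variance-reduced descent on the surrogate `f_j(x) + ⟨s_j - ∇f_j(y_j),
x⟩`. Its gradient differs from `∇f(x)` by the tracking error `s_j - ∇f(y_j)` plus the increment of
`∇f_j - ∇f` from `y_j` to `x`. By homogeneity that increment is at most `σ/200 · ‖x - y_j‖`, small
against strong convexity, so solving the surrogate well nearly minimizes `f`, up to the tracking
error. With `δ` of order `1/L` and `S` of order `κ`, the loop contracts a potential in expectation
(`sum_potential_innerLoop_le`). For SVRG this is the suboptimality, via the distance to the
surrogate's solution (`sum_bregman_svrg_le`). For SARAH it is `‖∇f‖²/σ`, via descent along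
directions that stay close to the gradient (`sum_sq_norm_gradient_sarah_le`).

Mixing preserves averages and contracts dispersion. Dispersion enters with weight `L²/σ`, while the
potential only controls `σ` times squared distances; this loss of `κ²` is what `α₀^K ≤ c/κ` repairs.
Mixing barely raises the potential itself: by Jensen for SVRG, and for SARAH because gradients of
quadratics commute with averaging (`sum_potential_le_of_average_eq`). The average of the `s_j`
always equals that of the `∇f_j(y_j)`, so the tracking error contracts up to dispersion and
homogeneity terms (`sum_sq_norm_tracking_le`).

A weighted sum of the potentials before and after mixing, the dispersion and the tracking error is
therefore halved in expectation by each iteration (`integral_lyapunov_run_succ_le`). It dominates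
`e_t²` up to the factor `2/σ`, so `E[e_t]` decays like `(3/4)^t`. The communication count follows
from `α₀ ≤ exp(-(1 - α₀))`. -/

noncomputable section

namespace NetVR

section

/-! ### Quadratic bounds along segments and Bregman divergences -/

section Gradient

variable {E : Type*} [NormedAddCommGroup E] [InnerProductSpace ℝ E] [CompleteSpace E]

theorem hasDerivAt_along_line {f : E → ℝ} (hf : Differentiable ℝ f) (y v : E) (t : ℝ) :
    HasDerivAt (fun t : ℝ => f (y + t • v)) (inner ℝ (gradient f (y + t • v)) v) t := by
  have h1 : HasDerivAt (fun t : ℝ => y + t • v) v t := by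
    simpa using ((hasDerivAt_id t).smul_const v).const_add y
  have h2 := (hf (y + t • v)).hasFDerivAt.comp_hasDerivAt t h1
  rwa [inner_gradient_left]

/-- An upper bound for the gradient's monotonicity form gives a quadratic upper bound; `M` may be
negative. -/
theorem le_quadratic_of_inner_gradient_le {f : E → ℝ} (hf : Differentiable ℝ f) {M : ℝ}
    (h : ∀ x y, inner ℝ (gradient f x - gradient f y) (x - y) ≤ M * ‖x - y‖ ^ 2) (x y : E) :
    f x ≤ f y + inner ℝ (gradient f y) (x - y) + M / 2 * ‖x - y‖ ^ 2 := by
  set v := x - y with hv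
  -- On the segment from `y` to `x`, `f` minus the claimed bound has nonpositive derivative.
  let φ : ℝ → ℝ := fun t => f (y + t • v) - (t * inner ℝ (gradient f y) v + M / 2 * ‖v‖ ^ 2 * t ^ 2)
  have hφ : ∀ t, HasDerivAt φ (inner ℝ (gradient f (y + t • v)) v
      - (inner ℝ (gradient f y) v + M * ‖v‖ ^ 2 * t)) t := by
    intro t
    have h1 := (hasDerivAt_id t).mul_const (inner ℝ (gradient f y) v)
    have h2 := ((hasDerivAt_id t).pow 2).const_mul (M / 2 * ‖v‖ ^ 2)
    refine ((hasDerivAt_along_line hf y v t).sub (h1.add h2)).congr_deriv ?_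
    simp
    ring
  have hanti : AntitoneOn φ (Set.Icc 0 1) := by
    refine antitoneOn_of_deriv_nonpos (convex_Icc 0 1)
      (fun t _ => (hφ t).continuousAt.continuousWithinAt)
      (fun t _ => (hφ t).differentiableAt.differentiableWithinAt) ?_
    intro t ht
    rw [interior_Icc] at ht
    rw [(hφ t).deriv]
    have h1 := h (y + t • v) y
    rw [add_sub_cancel_left, inner_smul_right, norm_smul, inner_sub_left, Real.norm_eq_abs,
      mul_pow, sq_abs] at h1
    have h2 : t * (inner ℝ (gradient f (y + t • v)) v - inner ℝ (gradient f y) v) ≤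
      t * (M * ‖v‖ ^ 2 * t) := by nlinarith
    have := le_of_mul_le_mul_left h2 ht.1
    linarith
  have h01 := hanti (Set.left_mem_Icc.2 zero_le_one) (Set.right_mem_Icc.2 zero_le_one) zero_le_one
  simp only [φ, one_smul, zero_smul, add_zero] at h01
  have hx : y + v = x := by rw [hv]; abel
  rw [hx] at h01
  linarith

theorem gradient_neg (f : E → ℝ) (x : E) : gradient (fun z => -f z) x = -gradient f x := by
  simp only [gradient]
  rw [fderiv_fun_neg, map_neg]

theorem quadratic_le_of_le_inner_gradient {f : E → ℝ} (hf : Differentiable ℝ f) {M : ℝ}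
    (h : ∀ x y, M * ‖x - y‖ ^ 2 ≤ inner ℝ (gradient f x - gradient f y) (x - y)) (x y : E) :
    f y + inner ℝ (gradient f y) (x - y) + M / 2 * ‖x - y‖ ^ 2 ≤ f x := by
  have := le_quadratic_of_inner_gradient_le (f := fun z => -f z) hf.neg (M := -M) (fun a b => by
    have := h a b
    rw [gradient_neg, gradient_neg, ← neg_sub', inner_neg_left]
    linarith) x y
  simp only [gradient_neg, inner_neg_left] at this
  linarith

theorem add_inner_gradient_le {f : E → ℝ} (hf : Differentiable ℝ f)
    (hc : ConvexOn ℝ Set.univ f) (x y : E) : f y + inner ℝ (gradient f y) (x - y) ≤ f x := by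
  have h1 := hasDerivAt_along_line hf y (x - y) 0
  have hc' : ConvexOn ℝ Set.univ (fun t : ℝ => f (y + t • (x - y))) := by
    refine ⟨convex_univ, fun a _ b _ s t hs ht hst => ?_⟩
    have := hc.2 (Set.mem_univ (y + a • (x - y))) (Set.mem_univ (y + b • (x - y))) hs ht hst
    convert this using 2
    have : y = (s + t) • y := by rw [hst, one_smul]
    nth_rewrite 1 [this]
    module
  have h2 := hc'.le_slope_of_hasDerivAt (Set.mem_univ 0) (Set.mem_univ 1) zero_lt_one h1
  simp only [slope_def_field, one_smul, zero_smul, add_zero, add_sub_cancel, sub_zero, div_one] at h2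
  linarith

theorem gradient_const_mul_sum {ι : Type*} (s : Finset ι) (a : ℝ) {f : ι → E → ℝ}
    (hf : ∀ i ∈ s, Differentiable ℝ (f i)) (x : E) :
    gradient (fun z => a * ∑ i ∈ s, f i z) x = a • ∑ i ∈ s, gradient (f i) x := by
  simp only [gradient]
  rw [fderiv_const_mul (DifferentiableAt.fun_sum fun i hi => hf i hi x),
    fderiv_fun_sum fun i hi => hf i hi x]
  simp

/-- The Bregman divergence of `f`. -/
def bregman (f : E → ℝ) (x y : E) : ℝ := f x - f y - inner ℝ (gradient f y) (x - y)

theorem bregman_add_bregman (f : E → ℝ) (x y : E) :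
    bregman f x y + bregman f y x = inner ℝ (gradient f x - gradient f y) (x - y) := by
  simp only [bregman, inner_sub_left, inner_sub_right]
  ring

end Gradient

/-! ### Smooth convex and strongly monotone functions -/

variable {d : ℕ}

theorem inner_le_of_lipschitz {L : ℝ} {G : Vec d → Vec d}
    (h : ∀ x y, ‖G x - G y‖ ≤ L * ‖x - y‖) (x y : Vec d) :
    inner ℝ (G x - G y) (x - y) ≤ L * ‖x - y‖ ^ 2 := by
  have h1 := real_inner_le_norm (G x - G y) (x - y)
  nlinarith [h x y, norm_nonneg (x - y)]

theorem IsConvexSmooth.bregman_nonneg {L : ℝ} {g : Vec d → ℝ} (hg : IsConvexSmooth L g)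
    (x y : Vec d) : 0 ≤ bregman g x y := by
  have := add_inner_gradient_le hg.differentiable hg.convex x y
  simp only [bregman]; linarith

/-- By convexity `g - ⟨∇g y, ·⟩` is minimal at `y`. The point `w` is a gradient step of length `1/L`
for it from `x`, and the decrease that smoothness guarantees cannot exceed the gap to the minimum,
which is `bregman g x y`. -/
theorem IsConvexSmooth.sq_norm_gradient_sub_le {L : ℝ} (hL : 0 < L) {g : Vec d → ℝ}
    (hg : IsConvexSmooth L g) (x y : Vec d) :
    ‖gradient g x - gradient g y‖ ^ 2 ≤ 2 * L * bregman g x y := by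
  set D := gradient g x - gradient g y with hD
  set w := x - L⁻¹ • D with hw
  have h1 := add_inner_gradient_le hg.differentiable hg.convex w y
  have h2 := le_quadratic_of_inner_gradient_le hg.differentiable (inner_le_of_lipschitz hg.lipschitz)
    w x
  have e1 : w - y = (x - y) - L⁻¹ • D := by rw [hw]; abel
  have e2 : w - x = -(L⁻¹ • D) := by rw [hw]; abel
  rw [e1, inner_sub_right, inner_smul_right] at h1
  rw [e2, norm_neg, inner_neg_right, inner_smul_right, norm_smul, mul_pow, Real.norm_eq_abs,
    sq_abs] at h2
  have h3 : inner ℝ (gradient g x) D - inner ℝ (gradient g y) D = ‖D‖ ^ 2 := by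
    rw [← inner_sub_left, ← hD, real_inner_self_eq_norm_sq]
  have h4 : L / 2 * (L⁻¹ ^ 2 * ‖D‖ ^ 2) = L⁻¹ * ‖D‖ ^ 2 / 2 := by field_simp
  have h5 : L⁻¹ * ‖D‖ ^ 2 / 2 ≤ bregman g x y := by
    rw [h4] at h2
    simp only [bregman]
    have : L⁻¹ * inner ℝ (gradient g x) D - L⁻¹ * inner ℝ (gradient g y) D = L⁻¹ * ‖D‖ ^ 2 := by
      rw [← mul_sub, h3]
    linarith
  have h6 : ‖D‖ ^ 2 = 2 * L * (L⁻¹ * ‖D‖ ^ 2 / 2) := by field_simp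
  rw [h6]
  exact mul_le_mul_of_nonneg_left h5 (by positivity)

theorem IsConvexSmooth.sq_norm_gradient_sub_le_inner {L : ℝ} (hL : 0 < L) {g : Vec d → ℝ}
    (hg : IsConvexSmooth L g) (x y : Vec d) :
    ‖gradient g x - gradient g y‖ ^ 2 ≤ L * inner ℝ (gradient g x - gradient g y) (x - y) := by
  have h1 := hg.sq_norm_gradient_sub_le hL x y
  have h2 := hg.sq_norm_gradient_sub_le hL y x
  rw [norm_sub_rev] at h2
  rw [← bregman_add_bregman]
  linarith

/-- `f` is differentiable, with `σ`-strongly monotone and `L`-Lipschitz gradient. -/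
structure IsStronglyMonotoneSmooth (σ L : ℝ) (f : Vec d → ℝ) : Prop where
  differentiable : Differentiable ℝ f
  lipschitz : ∀ x y, ‖gradient f x - gradient f y‖ ≤ L * ‖x - y‖
  strong : ∀ x y, σ * ‖x - y‖ ^ 2 ≤ inner ℝ (gradient f x - gradient f y) (x - y)

namespace IsStronglyMonotoneSmooth

variable {σ L : ℝ} {f : Vec d → ℝ}

theorem le_bregman (hf : IsStronglyMonotoneSmooth σ L f) (x y : Vec d) :
    σ / 2 * ‖x - y‖ ^ 2 ≤ bregman f x y := by
  have := quadratic_le_of_le_inner_gradient hf.differentiable hf.strong x y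
  simp only [bregman]; linarith

theorem bregman_le (hf : IsStronglyMonotoneSmooth σ L f) (x y : Vec d) :
    bregman f x y ≤ L / 2 * ‖x - y‖ ^ 2 := by
  have := le_quadratic_of_inner_gradient_le hf.differentiable (inner_le_of_lipschitz hf.lipschitz)
    x y
  simp only [bregman]; linarith

theorem norm_sub_le (hf : IsStronglyMonotoneSmooth σ L f) (x y : Vec d) :
    σ * ‖x - y‖ ≤ ‖gradient f x - gradient f y‖ := by
  have h1 := (hf.strong x y).trans (real_inner_le_norm _ _)
  rcases (norm_nonneg (x - y)).eq_or_lt with h | h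
  · rw [← h]; simp
  · have : (σ * ‖x - y‖) * ‖x - y‖ ≤ ‖gradient f x - gradient f y‖ * ‖x - y‖ := by nlinarith
    exact le_of_mul_le_mul_right this h

/-- The gradient of a strongly convex function is onto. -/
theorem exists_gradient_eq (hf : IsStronglyMonotoneSmooth σ L f) (hσ : 0 < σ)
    (p : Vec d) : ∃ u, gradient f u = p := by
  -- The tilted function `f - ⟨p, ·⟩` grows quadratically, so it attains its minimum, and there `∇f
  -- = p`.
  have hcont : Continuous fun x => f x - inner ℝ p x :=
    hf.differentiable.continuous.sub (continuous_const.inner continuous_id)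
  set a := gradient f 0 - p with ha
  have hlow : ∀ x, f 0 + (σ / 2 * ‖x‖ - ‖a‖) * ‖x‖ ≤ f x - inner ℝ p x := by
    intro x
    have h1 := hf.le_bregman x 0
    simp only [bregman, sub_zero] at h1
    have h2 : -(‖a‖ * ‖x‖) ≤ inner ℝ a x := (abs_le.1 (abs_real_inner_le_norm a x)).1
    rw [ha, inner_sub_left] at h2
    nlinarith
  have hlim : Filter.Tendsto (fun x => f x - inner ℝ p x) (Filter.cocompact (Vec d))
      Filter.atTop := by
    refine Filter.tendsto_atTop_mono hlow ?_
    have hn := tendsto_norm_cocompact_atTop (E := Vec d)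
    refine Filter.tendsto_atTop_add_const_left _ _ ?_
    refine Filter.Tendsto.atTop_mul_atTop₀ ?_ hn
    exact Filter.tendsto_atTop_add_const_right _ _ (hn.const_mul_atTop (by positivity))
  obtain ⟨u, hu⟩ := hcont.exists_forall_le hlim
  refine ⟨u, ?_⟩
  have hmin : IsLocalMin (fun x => f x - inner ℝ p x) u := Filter.Eventually.of_forall hu
  have h0 := hmin.fderiv_eq_zero
  have h1 : HasFDerivAt (fun x => f x - inner ℝ p x) (fderiv ℝ f u - innerSL ℝ p) u :=
    (hf.differentiable u).hasFDerivAt.sub (innerSL ℝ p).hasFDerivAt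
  rw [h1.fderiv, sub_eq_zero] at h0
  refine ext_inner_right ℝ fun v => ?_
  rw [inner_gradient_left, h0, innerSL_apply_apply]

end IsStronglyMonotoneSmooth

theorem gradient_eq_zero_of_isMinOn {f : Vec d → ℝ} {o : Vec d} (h : IsMinOn f Set.univ o) :
    gradient f o = 0 := by
  have h0 := (h.isLocalMin Filter.univ_mem).fderiv_eq_zero
  simp [gradient, h0]

/-! ### Averaged losses and the homogeneity parameter -/

section Losses

variable {n m : ℕ} {loss : Fin n → Fin m → Vec d → ℝ} {σ L : ℝ}

theorem gradient_localLoss (h : ∀ j i, IsConvexSmooth L (loss j i)) (j : Fin n) (x : Vec d) :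
    gradient (localLoss loss j) x = (m : ℝ)⁻¹ • ∑ i, gradient (loss j i) x :=
  gradient_const_mul_sum _ _ (fun i _ => (h j i).differentiable) x

theorem gradient_globalLoss (h : ∀ j, Differentiable ℝ (localLoss loss j)) (x : Vec d) :
    gradient (globalLoss loss) x = (n : ℝ)⁻¹ • ∑ j, gradient (localLoss loss j) x :=
  gradient_const_mul_sum _ _ (fun j _ => h j) x

theorem differentiable_globalLoss (h : ∀ j, Differentiable ℝ (localLoss loss j)) :
    Differentiable ℝ (globalLoss loss) :=
  (Differentiable.fun_sum fun j _ => h j).const_mul _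

theorem bregman_localLoss (h : ∀ j i, IsConvexSmooth L (loss j i)) (j : Fin n) (x y : Vec d) :
    bregman (localLoss loss j) x y = (m : ℝ)⁻¹ * ∑ i, bregman (loss j i) x y := by
  simp only [bregman, gradient_localLoss h, inner_smul_left, sum_inner, Finset.sum_sub_distrib,
    localLoss]
  simp
  ring

theorem norm_mean_le {ι : Type*} [Fintype ι] [Nonempty ι] {v : ι → Vec d} {C : ℝ}
    (h : ∀ i, ‖v i‖ ≤ C) : ‖(Fintype.card ι : ℝ)⁻¹ • ∑ i, v i‖ ≤ C := by
  have hc : (0 : ℝ) < Fintype.card ι := by exact_mod_cast Fintype.card_pos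
  rw [norm_smul, norm_inv, Real.norm_natCast, inv_mul_le_iff₀ hc]
  calc ‖∑ i, v i‖ ≤ ∑ i, ‖v i‖ := norm_sum_le _ _
    _ ≤ ∑ _i : ι, C := Finset.sum_le_sum fun i _ => h i
    _ = _ := by simp

theorem lipschitz_gradient_localLoss (hm : 0 < m) (h : ∀ j i, IsConvexSmooth L (loss j i))
    (j : Fin n) (x y : Vec d) :
    ‖gradient (localLoss loss j) x - gradient (localLoss loss j) y‖ ≤ L * ‖x - y‖ := by
  have : Nonempty (Fin m) := ⟨⟨0, hm⟩⟩
  rw [gradient_localLoss h, gradient_localLoss h, ← smul_sub, ← Finset.sum_sub_distrib]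
  simpa using norm_mean_le fun i => (h j i).lipschitz x y

/-- A lower bound on the Hessian makes the gradient strongly monotone. -/
theorem IsStronglyConvexSmooth.le_inner_gradient_sub {f : Vec d → ℝ}
    (hf : IsStronglyConvexSmooth σ L f) (x y : Vec d) :
    σ * ‖x - y‖ ^ 2 ≤ inner ℝ (gradient f x - gradient f y) (x - y) := by
  set v := x - y with hv
  have hd : ∀ t : ℝ, HasDerivAt (fun t : ℝ => inner ℝ (gradient f (y + t • v)) v)
      (inner ℝ (hessian f (y + t • v) v) v) t := by
    intro t
    have h1 : HasDerivAt (fun t : ℝ => y + t • v) v t := by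
      simpa using ((hasDerivAt_id t).smul_const v).const_add y
    have h2 := (hf.differentiable_gradient (y + t • v)).hasFDerivAt.comp_hasDerivAt t h1
    simpa [hessian] using h2.inner ℝ (hasDerivAt_const t v)
  have h := (convex_Icc (0 : ℝ) 1).mul_sub_le_image_sub_of_le_deriv
    (f := fun t : ℝ => inner ℝ (gradient f (y + t • v)) v) (C := σ * ‖v‖ ^ 2)
    (fun t _ => (hd t).continuousAt.continuousWithinAt)
    (fun t _ => (hd t).differentiableAt.differentiableWithinAt)
    (fun t _ => by rw [(hd t).deriv]; exact hf.lower _ _)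
    0 (Set.left_mem_Icc.2 zero_le_one) 1 (Set.right_mem_Icc.2 zero_le_one) zero_le_one
  have hx : y + v = x := by rw [hv]; abel
  simp only [one_smul, zero_smul, add_zero, hx, sub_zero, mul_one] at h
  rw [inner_sub_left]
  exact h

theorem isStronglyMonotoneSmooth_localLoss (hm : 0 < m)
    (h : ∀ j i, IsConvexSmooth L (loss j i))
    (h' : ∀ j, IsStronglyConvexSmooth σ L (localLoss loss j)) (j : Fin n) :
    IsStronglyMonotoneSmooth σ L (localLoss loss j) :=
  ⟨(h' j).differentiable, lipschitz_gradient_localLoss hm h j, (h' j).le_inner_gradient_sub⟩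

theorem isStronglyMonotoneSmooth_globalLoss (hn : 0 < n)
    (h : ∀ j, IsStronglyMonotoneSmooth σ L (localLoss loss j)) :
    IsStronglyMonotoneSmooth σ L (globalLoss loss) := by
  have : Nonempty (Fin n) := ⟨⟨0, hn⟩⟩
  have hg := gradient_globalLoss fun j => (h j).differentiable
  have hn' : (0 : ℝ) < n := by exact_mod_cast hn
  refine ⟨differentiable_globalLoss fun j => (h j).differentiable, fun x y => ?_, fun x y => ?_⟩
  · rw [hg, hg, ← smul_sub, ← Finset.sum_sub_distrib]
    simpa using norm_mean_le fun i => (h i).lipschitz x y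
  · rw [hg, hg, ← smul_sub, ← Finset.sum_sub_distrib, inner_smul_left, sum_inner]
    simp only [map_inv₀, conj_trivial]
    rw [le_inv_mul_iff₀ hn']
    calc (n : ℝ) * (σ * ‖x - y‖ ^ 2) = ∑ _j : Fin n, σ * ‖x - y‖ ^ 2 := by simp
      _ ≤ _ := Finset.sum_le_sum fun j _ => (h j).strong x y

theorem norm_hessian_le {f : Vec d → ℝ} (hL : 0 ≤ L)
    (h : ∀ x y, ‖gradient f x - gradient f y‖ ≤ L * ‖x - y‖) (x : Vec d) :
    ‖hessian f x‖ ≤ L := by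
  have : LipschitzWith ⟨L, hL⟩ (gradient f) := LipschitzWith.of_dist_le_mul fun a b => by
    rw [dist_eq_norm, dist_eq_norm]; exact h a b
  exact norm_fderiv_le_of_lipschitz ℝ this

theorem norm_hessian_sub_le_homogeneity (hL : 0 ≤ L) (hn : 0 < n)
    (h : ∀ j, IsStronglyMonotoneSmooth σ L (localLoss loss j)) (j : Fin n) (x : Vec d) :
    ‖hessian (localLoss loss j) x - hessian (globalLoss loss) x‖ ≤ homogeneity loss := by
  -- A real `⨆` of an unbounded family is `0`, so `homogeneity` bounds its members only because the
  -- Hessian differences are uniformly at most `2L`.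
  have hb : ∀ j x, ‖hessian (localLoss loss j) x - hessian (globalLoss loss) x‖ ≤ L + L :=
    fun j x => (norm_sub_le _ _).trans (add_le_add (norm_hessian_le hL (h j).lipschitz x)
      (norm_hessian_le hL (isStronglyMonotoneSmooth_globalLoss hn h).lipschitz x))
  refine (le_ciSup (f := fun x => ‖hessian (localLoss loss j) x - hessian (globalLoss loss) x‖)
    ⟨L + L, ?_⟩ x).trans (le_ciSup (f := fun j => ⨆ x : Vec d,
      ‖hessian (localLoss loss j) x - hessian (globalLoss loss) x‖) (Set.finite_range _).bddAbove j)
  rintro _ ⟨x, rfl⟩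
  exact hb j x

theorem norm_gradient_sub_sub_le_homogeneity (hL : 0 ≤ L) (hn : 0 < n)
    (h : ∀ j, IsStronglyMonotoneSmooth σ L (localLoss loss j))
    (h' : ∀ j, Differentiable ℝ (gradient (localLoss loss j))) (j : Fin n) (x y : Vec d) :
    ‖(gradient (localLoss loss j) x - gradient (globalLoss loss) x)
      - (gradient (localLoss loss j) y - gradient (globalLoss loss) y)‖
      ≤ homogeneity loss * ‖x - y‖ := by
  have hgd : Differentiable ℝ (gradient (globalLoss loss)) := by
    rw [funext (gradient_globalLoss fun j => (h j).differentiable)]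
    exact (Differentiable.fun_sum fun j _ => h' j).const_smul (n : ℝ)⁻¹
  refine convex_univ.norm_image_sub_le_of_norm_fderiv_le (𝕜 := ℝ)
    (f := fun x => gradient (localLoss loss j) x - gradient (globalLoss loss) x)
    (fun z _ => ((h' j).sub hgd) z) (fun z _ => ?_) (Set.mem_univ y) (Set.mem_univ x)
  rw [fderiv_fun_sub (h' j z) (hgd z)]
  exact norm_hessian_sub_le_homogeneity hL hn h j z

end Losses

end

/-! ### Averaging over sample sequences -/

section

theorem sq_norm_add_le {E : Type*} [SeminormedAddCommGroup E] (a b : E) :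
    ‖a + b‖ ^ 2 ≤ 2 * (‖a‖ ^ 2 + ‖b‖ ^ 2) := by
  nlinarith [norm_add_le a b, norm_nonneg (a + b), sq_nonneg (‖a‖ - ‖b‖)]

theorem sq_norm_sub_le {E : Type*} [SeminormedAddCommGroup E] (a b : E) :
    ‖a - b‖ ^ 2 ≤ 2 * (‖a‖ ^ 2 + ‖b‖ ^ 2) := by
  simpa [sub_eq_add_neg] using sq_norm_add_le a (-b)

section Sums

variable {E : Type*} [NormedAddCommGroup E] [InnerProductSpace ℝ E] {ι : Type*} [Fintype ι]

theorem sum_sq_norm_add (a : E) (v : ι → E) :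
    ∑ i, ‖a + v i‖ ^ 2 = Fintype.card ι * ‖a‖ ^ 2 + 2 * inner ℝ a (∑ i, v i) + ∑ i, ‖v i‖ ^ 2 := by
  simp only [norm_add_sq_real, Finset.sum_add_distrib, ← Finset.mul_sum, inner_sum]
  simp

theorem sum_sq_norm_sub_mean {w : ι → E} {p : E} (h : ∑ i, w i = (Fintype.card ι : ℝ) • p) :
    ∑ i, ‖w i - p‖ ^ 2 = ∑ i, ‖w i‖ ^ 2 - Fintype.card ι * ‖p‖ ^ 2 := by
  have h1 := sum_sq_norm_add (-p) w
  simp only [neg_add_eq_sub, norm_neg, h, inner_neg_left, inner_smul_right,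
    real_inner_self_eq_norm_sq] at h1
  rw [h1]; ring

theorem sum_le_sub_of_succ_le {S : ℕ} {a : Fin (S + 1) → ℝ} {b : Fin S → ℝ}
    (h : ∀ k : Fin S, a k.succ ≤ a k.castSucc - b k) : ∑ k, b k ≤ a 0 - a (Fin.last S) := by
  induction S with
  | zero => simp
  | succ S ih =>
    rw [Fin.sum_univ_castSucc]
    have h1 := ih (a := fun k => a k.castSucc) (b := fun k => b k.castSucc)
      (fun k => by simpa using h k.castSucc)
    have h2 := h (Fin.last S)
    simp only [Fin.succ_last, Fin.castSucc_zero] at h1 h2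
    linarith

/-- Resampling one coordinate does not change a sum over all tuples. -/
theorem sum_sum_update {S m : ℕ} (ψ : (Fin S → Fin m) → ℝ) (k : Fin S) :
    ∑ z, ∑ i, ψ (Function.update z k i) = m * ∑ z, ψ z := by
  -- Exchanging the `k`-th entry of `z` with the extra index `i` permutes the pairs `(z, i)`.
  have hinv : Function.Involutive
      (fun p : (Fin S → Fin m) × Fin m => (Function.update p.1 k p.2, p.1 k)) := by
    rintro ⟨z, i⟩
    simp
  have h := Equiv.sum_comp hinv.toPerm (fun p : (Fin S → Fin m) × Fin m => ψ p.1)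
  rw [Fintype.sum_prod_type, Fintype.sum_prod_type] at h
  simpa [Finset.mul_sum] using h

end Sums

variable {n m d S : ℕ}

/-- One step of the inner loop. -/
def innerStep (alg : Variant) (g : Vec d → ℝ) (δ : ℝ) (y s : Vec d) (uv : Vec d × Vec d) :
    Vec d × Vec d :=
  (uv.1 - δ • uv.2, direction alg g y s uv.1 uv.2 (uv.1 - δ • uv.2))

section InnerLoop

variable (alg : Variant) (g : Fin m → Vec d → ℝ) (δ : ℝ) (y s : Vec d)

theorem innerLoop_succ (z : Fin S → Fin m) (k : Fin S) :
    innerLoop alg g δ y s z k.succ =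
      innerStep alg (g (z k)) δ y s (innerLoop alg g δ y s z k.castSucc) := rfl

/-- Entry `l` reads only the samples with index below `l`, so `z k` is still fresh when entry
`k.succ` is formed. -/
theorem innerLoop_update_of_le (z : Fin S → Fin m) (k : Fin S) (i : Fin m) (l : Fin (S + 1))
    (hl : l ≤ k.castSucc) :
    innerLoop alg g δ y s (Function.update z k i) l = innerLoop alg g δ y s z l := by
  induction l using Fin.induction with
  | zero => rfl
  | succ l ih =>
    have hlk : l < k := Fin.succ_le_castSucc_iff.1 hl
    rw [innerLoop_succ, innerLoop_succ, ih ((Fin.castSucc_lt_castSucc_iff.2 hlk).le),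
      Function.update_of_ne hlk.ne]

/-- The tower property in counting form: conditioning on the past amounts to resampling coordinate
`k`, on which entry `k.castSucc` does not depend. -/
theorem sum_innerLoop_succ (hm : 0 < m) (ψ : Vec d × Vec d → ℝ) (k : Fin S) :
    ∑ z, ψ (innerLoop alg g δ y s z k.succ) =
      ∑ z, (m : ℝ)⁻¹ * ∑ i, ψ (innerStep alg (g i) δ y s (innerLoop alg g δ y s z k.castSucc)) := by
  have h := sum_sum_update (fun z => ψ (innerLoop alg g δ y s z k.succ)) k
  have hm' : (m : ℝ) ≠ 0 := by exact_mod_cast hm.ne'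
  rw [← Finset.mul_sum, eq_inv_mul_iff_mul_eq₀ hm', ← h]
  refine Finset.sum_congr rfl fun z _ => Finset.sum_congr rfl fun i _ => ?_
  rw [innerLoop_succ, innerLoop_update_of_le _ _ _ _ _ _ _ _ _ le_rfl, Function.update_self]

end InnerLoop

/-! ### Variance reduction: the SVRG and SARAH inner loops -/

variable {loss : Fin n → Fin m → Vec d → ℝ} {σ L δ : ℝ}

theorem sum_gradient_loss (hm : 0 < m) (h : ∀ j i, IsConvexSmooth L (loss j i)) (j : Fin n)
    (x : Vec d) : ∑ i, gradient (loss j i) x = (m : ℝ) • gradient (localLoss loss j) x := by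
  have hm' : (m : ℝ) ≠ 0 := by exact_mod_cast hm.ne'
  rw [gradient_localLoss h, smul_smul, mul_inv_cancel₀ hm', one_smul]

/-- One SVRG step, in mean square distance to the point `o` with `s = ∇f_j(y) - ∇f_j(o)`. -/
theorem mean_sq_norm_svrg_step_le (hm : 0 < m) (hL : 0 < L) (hδ : 0 ≤ δ)
    (h : ∀ j i, IsConvexSmooth L (loss j i)) (j : Fin n) {y s o : Vec d}
    (hs : s = gradient (localLoss loss j) y - gradient (localLoss loss j) o) (u : Vec d) :
    (m : ℝ)⁻¹ * ∑ i, ‖u - δ • (gradient (loss j i) u - gradient (loss j i) y + s) - o‖ ^ 2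
      ≤ ‖u - o‖ ^ 2 - 2 * δ * (1 - 2 * L * δ) * bregman (localLoss loss j) u o
        + 4 * δ ^ 2 * L * bregman (localLoss loss j) y o := by
  have hm' : (0 : ℝ) < m := by exact_mod_cast hm
  set f := localLoss loss j with hf
  set v : Fin m → Vec d := fun i => gradient (loss j i) u - gradient (loss j i) y + s with hv
  have hsum : ∑ i, v i = (m : ℝ) • (gradient f u - gradient f o) := by
    simp only [hv, Finset.sum_add_distrib, Finset.sum_sub_distrib, sum_gradient_loss hm h]
    rw [hs]
    simp only [Finset.sum_const, Finset.card_univ, Fintype.card_fin, ← Nat.cast_smul_eq_nsmul ℝ]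
    module
  have hv2 : ∑ i, ‖v i‖ ^ 2 ≤ m * (4 * L * (bregman f u o + bregman f y o)) := by
    -- Split at `o`. The second part is centred, because `s` is the mean of `∇ℓ_i(y) - ∇ℓ_i(o)`;
    -- dropping the centring only increases its second moment, and both parts are then bounded by
    -- Bregman divergences.
    have h1 : ∀ i, ‖v i‖ ^ 2 ≤ 2 * (‖gradient (loss j i) u - gradient (loss j i) o‖ ^ 2 +
        ‖(gradient (loss j i) y - gradient (loss j i) o) - s‖ ^ 2) := by
      intro i
      have : v i = (gradient (loss j i) u - gradient (loss j i) o) -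
        ((gradient (loss j i) y - gradient (loss j i) o) - s) := by simp only [hv]; abel
      rw [this]
      exact sq_norm_sub_le _ _
    have h2 : ∑ i, ‖(gradient (loss j i) y - gradient (loss j i) o) - s‖ ^ 2 ≤
        ∑ i, ‖gradient (loss j i) y - gradient (loss j i) o‖ ^ 2 := by
      rw [sum_sq_norm_sub_mean]
      · have : 0 ≤ (Fintype.card (Fin m) : ℝ) * ‖s‖ ^ 2 := by positivity
        linarith
      · rw [Finset.sum_sub_distrib, sum_gradient_loss hm h, sum_gradient_loss hm h, hs,
          Fintype.card_fin, smul_sub]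
    have h3 : ∀ x, ∑ i, ‖gradient (loss j i) x - gradient (loss j i) o‖ ^ 2 ≤
        m * (2 * L * bregman f x o) := by
      intro x
      calc ∑ i, ‖gradient (loss j i) x - gradient (loss j i) o‖ ^ 2
          ≤ ∑ i, 2 * L * bregman (loss j i) x o :=
            Finset.sum_le_sum fun i _ => (h j i).sq_norm_gradient_sub_le hL x o
        _ = _ := by
            rw [hf, bregman_localLoss h, ← Finset.mul_sum]
            field_simp
    have h4 := Finset.sum_le_sum fun i (_ : i ∈ Finset.univ) => h1 i
    rw [← Finset.mul_sum, Finset.sum_add_distrib] at h4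
    have := h3 u
    have := h3 y
    nlinarith
  have hexp : ∑ i, ‖u - δ • v i - o‖ ^ 2 = m * ‖u - o‖ ^ 2
      - 2 * δ * (m * (bregman f u o + bregman f o u)) + δ ^ 2 * ∑ i, ‖v i‖ ^ 2 := by
    have h1 := sum_sq_norm_add (u - o) (fun i => -(δ • v i))
    have h2 : ∀ i, u - δ • v i - o = u - o + -(δ • v i) := fun i => by abel
    simp only [h2, h1, Finset.sum_neg_distrib, ← Finset.smul_sum, hsum, inner_neg_right,
      inner_smul_right, norm_neg, norm_smul, mul_pow, Real.norm_eq_abs, sq_abs, ← Finset.mul_sum,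
      bregman_add_bregman, real_inner_comm (u - o), Fintype.card_fin]
    ring
  have hb : 0 ≤ bregman f o u := by
    rw [hf, bregman_localLoss h]
    have := Finset.sum_nonneg fun i (_ : i ∈ Finset.univ) => (h j i).bregman_nonneg o u
    positivity
  rw [hexp, inv_mul_le_iff₀ hm']
  have h5 := mul_le_mul_of_nonneg_left hv2 (sq_nonneg δ)
  have h6 : 0 ≤ δ * (m * bregman f o u) := by positivity
  linarith

/-- The SVRG inner loop contracts the mean Bregman divergence to the solution `o` of the local
subproblem. -/
theorem sum_bregman_svrg_le (hm : 0 < m) (hL : 0 < L) (hσ : 0 < σ) (hδ : 0 < δ) (hδL : L * δ ≤ 1 / 4)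
    (h : ∀ j i, IsConvexSmooth L (loss j i)) (j : Fin n)
    (hf : IsStronglyMonotoneSmooth σ L (localLoss loss j)) {y s o : Vec d}
    (hs : s = gradient (localLoss loss j) y - gradient (localLoss loss j) o) :
    2 * δ * (1 - 2 * L * δ) * ∑ r : Fin S, ∑ z,
        bregman (localLoss loss j) (innerLoop .svrg (loss j) δ y s z r.succ).1 o
      ≤ (m : ℝ) ^ S * ((2 / σ + 4 * δ ^ 2 * L * S) * bregman (localLoss loss j) y o) := by
  have hm' : (0 : ℝ) < m := by exact_mod_cast hm
  set f := localLoss loss j with hfdef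
  set I := innerLoop (S := S) .svrg (loss j) δ y s with hI
  -- Entry `k` already determines the next iterate `u^k - δ v^k`, whose distance is recorded here.
  -- The shift makes the telescoped divergences those of `u^1, …, u^S`, at the price of a virtual
  -- point `u^{S+1}`.
  let a : Fin (S + 1) → ℝ := fun k => ∑ z, ‖(I z k).1 - δ • (I z k).2 - o‖ ^ 2
  let b : Fin S → ℝ := fun k => 2 * δ * (1 - 2 * L * δ) * ∑ z, bregman f (I z k.succ).1 o
    - m ^ S * (4 * δ ^ 2 * L * bregman f y o)
  have hcard : ∀ t : ℝ, ∑ _z : Fin S → Fin m, t = m ^ S * t := by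
    intro t; simp
  have hstep : ∀ k, a k.succ ≤ a k.castSucc - b k := by
    intro k
    have e1 := sum_innerLoop_succ .svrg (loss j) δ y s hm
      (fun p => ‖p.1 - δ • p.2 - o‖ ^ 2) k
    have h1 := Finset.sum_le_sum fun z (_ : z ∈ Finset.univ) =>
      mean_sq_norm_svrg_step_le hm hL hδ.le h j hs ((I z k.succ).1)
    simp only [Finset.sum_add_distrib, Finset.sum_sub_distrib, ← Finset.mul_sum] at h1
    simp only [a, b]
    simp only [innerStep, direction, ← Finset.mul_sum] at e1
    rw [e1]
    refine h1.trans ?_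
    rw [hcard, Finset.mul_sum]
    have : ∀ z, (I z k.succ).1 = (I z k.castSucc).1 - δ • (I z k.castSucc).2 := fun z => rfl
    simp only [this, ← hfdef]
    rw [← Finset.mul_sum]
    apply le_of_eq
    ring
  have hsum := sum_le_sub_of_succ_le hstep
  have hlast : 0 ≤ a (Fin.last S) := Finset.sum_nonneg fun z _ => sq_nonneg _
  have ha0 : a 0 ≤ m ^ S * (2 / σ * bregman f y o) := by
    have : a 0 = ∑ _z : Fin S → Fin m, ‖y - δ • s - o‖ ^ 2 := rfl
    rw [this, hcard]
    refine mul_le_mul_of_nonneg_left ?_ (by positivity)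
    -- At `u = y` every sampled direction equals `s`, so the one-step bound also covers the
    -- deterministic first step.
    have h1 := mean_sq_norm_svrg_step_le hm hL hδ.le h j hs y
    simp only [sub_self, zero_add, Finset.sum_const, Finset.card_univ, Fintype.card_fin,
      nsmul_eq_mul, inv_mul_cancel_left₀ hm'.ne'] at h1
    have h2 := hf.le_bregman y o
    have h0 : 0 ≤ bregman f y o := le_trans (by positivity) h2
    have h3 : ‖y - o‖ ^ 2 ≤ 2 / σ * bregman f y o := by
      rw [div_mul_eq_mul_div, le_div_iff₀ hσ]; linarith
    have h4 : 0 ≤ δ * (1 - 4 * (L * δ)) * bregman f y o :=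
      mul_nonneg (mul_nonneg hδ.le (by linarith)) h0
    linarith
  simp only [b, Finset.sum_sub_distrib, ← Finset.mul_sum, Finset.sum_const, Finset.card_univ,
    Fintype.card_fin, nsmul_eq_mul] at hsum
  linarith

/-- One SARAH step does not increase the mean of `‖v - ∇F(u)‖² + Lδ ‖v‖²`, where
`∇F - ∇f_j` is the constant `p`. -/
theorem mean_sq_norm_sarah_step_le (hm : 0 < m) (hL : 0 < L) (hδL : L * δ ≤ 1)
    (h : ∀ j i, IsConvexSmooth L (loss j i)) (j : Fin n) (p u v : Vec d) :
    (m : ℝ)⁻¹ * ∑ i,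
        (‖gradient (loss j i) (u - δ • v) - gradient (loss j i) u + v
            - (gradient (localLoss loss j) (u - δ • v) + p)‖ ^ 2
          + L * δ * ‖gradient (loss j i) (u - δ • v) - gradient (loss j i) u + v‖ ^ 2)
      ≤ ‖v - (gradient (localLoss loss j) u + p)‖ ^ 2 + L * δ * ‖v‖ ^ 2 := by
  have hm' : (0 : ℝ) < m := by exact_mod_cast hm
  set f := localLoss loss j with hf
  set u' := u - δ • v with hu'
  set ξ : Fin m → Vec d := fun i => gradient (loss j i) u' - gradient (loss j i) u with hξ
  set q := gradient f u' - gradient f u with hq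
  set w := v - (gradient f u + p) with hw
  have hsum : ∑ i, ξ i = (m : ℝ) • q := by
    simp only [hξ, Finset.sum_sub_distrib, sum_gradient_loss hm h, ← smul_sub, hq, hf]
  have h1 : ∑ i, ‖ξ i + v - (gradient f u' + p)‖ ^ 2 ≤ m * ‖w‖ ^ 2 + ∑ i, ‖ξ i‖ ^ 2 := by
    have e : ∀ i, ξ i + v - (gradient f u' + p) = w + (ξ i - q) := fun i => by
      simp only [hw, hq]; abel
    have e2 : ∑ i, (ξ i - q) = 0 := by
      rw [Finset.sum_sub_distrib, hsum]
      simp only [Finset.sum_const, Finset.card_univ, Fintype.card_fin, ← Nat.cast_smul_eq_nsmul ℝ,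
        sub_self]
    simp only [e]
    rw [sum_sq_norm_add, e2, inner_zero_right, Fintype.card_fin,
      sum_sq_norm_sub_mean (by rw [hsum, Fintype.card_fin])]
    have : 0 ≤ (Fintype.card (Fin m) : ℝ) * ‖q‖ ^ 2 := by positivity
    linarith
  -- Since `u' - u = -δ v`, cocoercivity reads `‖ξ‖² ≤ -Lδ ⟨ξ, v⟩`: the cross term of `‖ξ + v‖²`
  -- pays for the new variance, sample by sample.
  have h2 : ∀ i, ‖ξ i‖ ^ 2 + L * δ * ‖ξ i + v‖ ^ 2 ≤ L * δ * ‖v‖ ^ 2 := by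
    intro i
    have h3 := (h j i).sq_norm_gradient_sub_le_inner hL u' u
    have e : u' - u = -(δ • v) := by rw [hu']; abel
    rw [e, inner_neg_right, inner_smul_right] at h3
    change ‖ξ i‖ ^ 2 ≤ L * -(δ * inner ℝ (ξ i) v) at h3
    rw [norm_add_sq_real]
    have h4 : L * δ * ‖ξ i‖ ^ 2 ≤ 1 * ‖ξ i‖ ^ 2 :=
      mul_le_mul_of_nonneg_right hδL (sq_nonneg _)
    linarith
  have h3 := Finset.sum_le_sum fun i (_ : i ∈ Finset.univ) => h2 i
  rw [inv_mul_le_iff₀ hm', Finset.sum_add_distrib]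
  rw [Finset.sum_add_distrib] at h3
  simp only [Finset.sum_const, Finset.card_univ, Fintype.card_fin, nsmul_eq_mul] at h3
  linarith

/-- In the SARAH inner loop the directions stay close to the gradient in mean square. -/
theorem sum_sq_norm_sarah_direction_sub_le (hm : 0 < m) (hL : 0 < L) (hδ : 0 < δ)
    (hδL : L * δ ≤ 1) (h : ∀ j i, IsConvexSmooth L (loss j i)) (j : Fin n) {y s p : Vec d}
    (hs : s = gradient (localLoss loss j) y + p) (k : Fin (S + 1)) :
    ∑ z : Fin S → Fin m, ‖(innerLoop .sarah (loss j) δ y s z k).2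
        - (gradient (localLoss loss j) (innerLoop .sarah (loss j) δ y s z k).1 + p)‖ ^ 2
      ≤ (m : ℝ) ^ S * (L * δ * ‖s‖ ^ 2) := by
  set f := localLoss loss j with hf
  set I := innerLoop (S := S) .sarah (loss j) δ y s with hI
  let ψ : Vec d × Vec d → ℝ := fun uv => ‖uv.2 - (gradient f uv.1 + p)‖ ^ 2 + L * δ * ‖uv.2‖ ^ 2
  have key : ∑ z, ψ (I z k) ≤ (m : ℝ) ^ S * (L * δ * ‖s‖ ^ 2) := by
    induction k using Fin.induction with
    | zero =>
      have : ∀ z, ψ (I z 0) = L * δ * ‖s‖ ^ 2 := fun z => by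
        change ‖s - (gradient f y + p)‖ ^ 2 + L * δ * ‖s‖ ^ 2 = _
        rw [← hs]; simp
      simp [this]
    | succ k ih =>
      refine le_trans ?_ ih
      rw [sum_innerLoop_succ _ _ _ _ _ hm]
      refine Finset.sum_le_sum fun z _ => ?_
      exact mean_sq_norm_sarah_step_le hm hL hδL h j p (I z k.castSucc).1 (I z k.castSucc).2
  refine le_trans (Finset.sum_le_sum fun z _ => ?_) key
  have : 0 ≤ L * δ * ‖(I z k).2‖ ^ 2 := by positivity
  simp only [ψ]
  linarith

/-- Descent of `F = f + ⟨p, ·⟩` along an inexact gradient step. -/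
theorem IsStronglyMonotoneSmooth.add_inner_sub_smul_le {f : Vec d → ℝ}
    (hf : IsStronglyMonotoneSmooth σ L f) (hδ : 0 < δ) (hδL : L * δ ≤ 1) (p u v : Vec d) :
    f (u - δ • v) + inner ℝ p (u - δ • v) ≤ f u + inner ℝ p u
      - δ / 2 * ‖gradient f u + p‖ ^ 2 + δ / 2 * ‖v - (gradient f u + p)‖ ^ 2 := by
  have h1 := hf.bregman_le (u - δ • v) u
  have e : u - δ • v - u = -(δ • v) := by abel
  rw [bregman, e, norm_neg, inner_neg_right, inner_smul_right, norm_smul, mul_pow, Real.norm_eq_abs,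
    sq_abs] at h1
  rw [norm_sub_sq_real, inner_add_right, inner_sub_right, inner_smul_right,
    real_inner_comm (gradient f u) v, real_inner_comm p v]
  have h2 : δ * (L * δ) * ‖v‖ ^ 2 ≤ δ * 1 * ‖v‖ ^ 2 := by gcongr
  linarith

/-- The surrogate `f + ⟨p, ·⟩` descends along the loop up to the direction errors. Since `s` is its
gradient at `y`, strong convexity limits the total decrease to `‖s‖² / (2σ)`; telescoping leaves the
squared gradients. -/
theorem sum_sq_norm_gradient_sarah_le (hm : 0 < m) (hL : 0 < L) (hσ : 0 < σ) (hδ : 0 < δ)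
    (hδL : L * δ ≤ 1) (h : ∀ j i, IsConvexSmooth L (loss j i)) (j : Fin n)
    (hf : IsStronglyMonotoneSmooth σ L (localLoss loss j)) {y s p : Vec d}
    (hs : s = gradient (localLoss loss j) y + p) :
    δ * ∑ r : Fin S, ∑ z, ‖gradient (localLoss loss j)
        (innerLoop .sarah (loss j) δ y s z r.succ).1 + p‖ ^ 2
      ≤ (m : ℝ) ^ S * ((1 / σ + δ * (L * δ) * S) * ‖s‖ ^ 2) := by
  set f := localLoss loss j with hfdef
  set I := innerLoop (S := S) .sarah (loss j) δ y s with hI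
  let F : Vec d → ℝ := fun u => f u + inner ℝ p u
  let a : Fin (S + 1) → ℝ := fun k => ∑ z, F ((I z k).1 - δ • (I z k).2)
  let b : Fin S → ℝ := fun k => δ / 2 * ∑ z, ‖gradient f (I z k.succ).1 + p‖ ^ 2
    - δ / 2 * (m ^ S * (L * δ * ‖s‖ ^ 2))
  have hcard : ∀ t : ℝ, ∑ _z : Fin S → Fin m, t = m ^ S * t := by
    intro t; simp
  have hstep : ∀ k, a k.succ ≤ a k.castSucc - b k := by
    intro k
    have h1 := Finset.sum_le_sum fun z (_ : z ∈ Finset.univ) =>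
      hf.add_inner_sub_smul_le hδ hδL p (I z k.succ).1 (I z k.succ).2
    have h2 := sum_sq_norm_sarah_direction_sub_le hm hL hδ hδL h j hs k.succ
    simp only [Finset.sum_add_distrib, Finset.sum_sub_distrib, ← Finset.mul_sum] at h1
    have h3 := mul_le_mul_of_nonneg_left h2 (half_pos hδ).le
    have h4 : a k.castSucc = ∑ z, (f (I z k.succ).1 + inner ℝ p (I z k.succ).1) := rfl
    rw [h4]
    simp only [a, b, F, Finset.sum_add_distrib]
    linarith
  have hsum := sum_le_sub_of_succ_le hstep
  have hFy : ∀ u, F y - ‖s‖ ^ 2 / (2 * σ) ≤ F u := by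
    intro u
    have h1 := hf.le_bregman u y
    have h2 : inner ℝ (gradient f y) (u - y) = inner ℝ s (u - y) - inner ℝ p (u - y) := by
      rw [← inner_sub_left, hs]; simp
    have h3 : -(‖s‖ * ‖u - y‖) ≤ inner ℝ s (u - y) := (abs_le.1 (abs_real_inner_le_norm _ _)).1
    rw [bregman, h2, inner_sub_right p] at h1
    have h4 : ‖s‖ * ‖u - y‖ ≤ ‖s‖ ^ 2 / (2 * σ) + σ / 2 * ‖u - y‖ ^ 2 := by
      rw [div_add' _ _ _ (by positivity), le_div_iff₀ (by positivity)]
      nlinarith [sq_nonneg (‖s‖ - σ * ‖u - y‖)]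
    simp only [F]
    linarith
  have hlast : (m : ℝ) ^ S * (F y - ‖s‖ ^ 2 / (2 * σ)) ≤ a (Fin.last S) := by
    rw [← hcard]
    exact Finset.sum_le_sum fun z _ => hFy _
  have ha0 : a 0 ≤ m ^ S * F y := by
    rw [← hcard]
    refine Finset.sum_le_sum fun z _ => ?_
    change F (y - δ • s) ≤ F y
    have h1 := hf.add_inner_sub_smul_le hδ hδL p y s
    rw [← hs, sub_self, norm_zero] at h1
    have : 0 ≤ δ / 2 * ‖s‖ ^ 2 := by positivity
    simp only [F]
    linarith
  simp only [b, Finset.sum_sub_distrib, ← Finset.mul_sum, Finset.sum_const, Finset.card_univ,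
    Fintype.card_fin, nsmul_eq_mul] at hsum
  have e : (1 / σ) * ‖s‖ ^ 2 = 2 * (‖s‖ ^ 2 / (2 * σ)) := by field_simp
  rw [add_mul, e]
  linarith

end

/-! ### The local surrogate against the global loss -/

section

variable {n m d S : ℕ} {loss : Fin n → Fin m → Vec d → ℝ} {σ L : ℝ}

/-- `f` and `F` are `β`-similar: the gradient of `f - F` is `β`-Lipschitz. -/
def IsSimilar (β : ℝ) (f F : Vec d → ℝ) : Prop :=
  ∀ x y, ‖(gradient f x - gradient F x) - (gradient f y - gradient F y)‖ ≤ β * ‖x - y‖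

theorem gradient_fun_sub {f F : Vec d → ℝ} (hf : Differentiable ℝ f) (hF : Differentiable ℝ F)
    (x : Vec d) : gradient (fun z => f z - F z) x = gradient f x - gradient F x := by
  simp only [gradient]
  rw [fderiv_fun_sub (hf x) (hF x), map_sub]

/-- The difference `f - F` need not be convex, but its `β`-Lipschitz gradient admits both quadratic
bounds, with moduli `β` and `-β`. -/
theorem IsSimilar.abs_bregman_sub_le {β : ℝ} {f F : Vec d → ℝ} (h : IsSimilar β f F)
    (hf : Differentiable ℝ f) (hF : Differentiable ℝ F) (x y : Vec d) :
    |bregman f x y - bregman F x y| ≤ β / 2 * ‖x - y‖ ^ 2 := by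
  have hd : Differentiable ℝ (fun z => f z - F z) := hf.sub hF
  have hi : ∀ x y, |inner ℝ ((gradient f x - gradient F x) - (gradient f y - gradient F y))
      (x - y)| ≤ β * ‖x - y‖ ^ 2 := fun x y => by
    refine (abs_real_inner_le_norm _ _).trans ?_
    rw [sq, ← mul_assoc]
    exact mul_le_mul_of_nonneg_right (h x y) (norm_nonneg _)
  have h1 := le_quadratic_of_inner_gradient_le hd (M := β) (fun a b => by
    rw [gradient_fun_sub hf hF, gradient_fun_sub hf hF]; exact (abs_le.1 (hi a b)).2) x y
  have h2 := quadratic_le_of_le_inner_gradient hd (M := -β) (fun a b => by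
    rw [gradient_fun_sub hf hF, gradient_fun_sub hf hF]
    have := (abs_le.1 (hi a b)).1
    linarith) x y
  rw [gradient_fun_sub hf hF, inner_sub_left] at h1 h2
  rw [abs_le, bregman, bregman]
  constructor <;> linarith

section LocalProblem

variable {f F : Vec d → ℝ} {o y s u : Vec d}

theorem sub_min_eq_bregman (ho : gradient F o = 0) (x : Vec d) : F x - F o = bregman F x o := by
  rw [bregman, ho, inner_zero_left, sub_zero]

/-- The initial suboptimality of the local subproblem with solution `u`. -/
theorem bregman_local_le (hσ : 0 < σ) (hf : IsStronglyMonotoneSmooth σ L f)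
    (hF : IsStronglyMonotoneSmooth σ L F) (hs : IsSimilar (σ / 200) f F) (ho : gradient F o = 0)
    (hu : gradient f u = gradient f y - s) :
    bregman f y u ≤ 6 * (F y - F o) + 3 * (‖s - gradient F y‖ ^ 2 / σ) := by
  set g := ‖s - gradient F y‖ with hg
  have hg0 : 0 ≤ g := norm_nonneg _
  have hyo := hF.le_bregman y o
  rw [← sub_min_eq_bregman ho] at hyo
  have hFu : F o ≤ F u := by
    have := hF.le_bregman u o
    rw [← sub_min_eq_bregman ho] at this
    have : 0 ≤ σ / 2 * ‖u - o‖ ^ 2 := by positivity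
    linarith
  have h1 : σ * ‖u - o‖ ≤ σ / 200 * ‖y - o‖ + g := by
    refine (hf.norm_sub_le u o).trans ?_
    have e : gradient f u - gradient f o = ((gradient f y - gradient F y) -
        (gradient f o - gradient F o)) - (s - gradient F y) := by rw [hu, ho]; abel
    rw [e]
    exact (_root_.norm_sub_le _ _).trans (by linarith [hs y o])
  have h2 : ‖y - u‖ ≤ ‖y - o‖ + ‖u - o‖ := by
    have := _root_.norm_sub_le (y - o) (u - o)
    rwa [sub_sub_sub_cancel_right] at this
  have h3 : bregman f y u ≤ F y - F u + σ / 400 * ‖y - u‖ ^ 2 + g * ‖y - u‖ := by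
    have h4 := abs_le.1 (hs.abs_bregman_sub_le hf.differentiable hF.differentiable u y)
    have h5 : inner ℝ (s - gradient F y) (y - u) ≤ g * ‖y - u‖ := real_inner_le_norm _ _
    have e : gradient f u = (gradient f y - gradient F y) - (s - gradient F y) := by
      rw [hu]; abel
    rw [norm_sub_rev] at h4
    have e2 : u - y = -(y - u) := by abel
    rw [bregman, bregman, e2, inner_neg_right, inner_neg_right] at h4
    rw [bregman, e, inner_sub_left, inner_sub_left]
    linarith [h4.1]
  set r := ‖y - u‖
  set b := ‖y - o‖
  have hG : g * r ≤ g ^ 2 / σ / 2 + σ * r ^ 2 / 2 := by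
    have : g ^ 2 / σ / 2 + σ * r ^ 2 / 2 - g * r = (g - σ * r) ^ 2 / (2 * σ) := by
      field_simp; ring
    have : 0 ≤ (g - σ * r) ^ 2 / (2 * σ) := by positivity
    linarith
  have hr : σ * r ^ 2 ≤ 2.1 * (σ * b ^ 2) + 2 * (g ^ 2 / σ) := by
    have h6 : σ * r ≤ 1.005 * (σ * b) + g := by
      have := mul_le_mul_of_nonneg_left h2 hσ.le
      linarith
    have h7 : (σ * r) ^ 2 ≤ 2.1 * (σ * b) ^ 2 + 2 * g ^ 2 := by
      have h8 : (σ * r) ^ 2 ≤ (1.005 * (σ * b) + g) ^ 2 :=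
        pow_le_pow_left₀ (by positivity) h6 2
      nlinarith [sq_nonneg (1.005 * (σ * b) - g), sq_nonneg (σ * b)]
    have h9 : σ * (σ * r ^ 2) ≤ σ * (2.1 * (σ * b ^ 2) + 2 * (g ^ 2 / σ)) := by
      have : σ * (2.1 * (σ * b ^ 2) + 2 * (g ^ 2 / σ)) = 2.1 * (σ * b) ^ 2 + 2 * g ^ 2 := by
        field_simp
      rw [this]; linarith
    exact le_of_mul_le_mul_left h9 hσ
  have hG0 : 0 ≤ g ^ 2 / σ := by positivity
  have hb0 : 0 ≤ σ * b ^ 2 := by positivity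
  linarith

/-- Global suboptimality in terms of the suboptimality of the local subproblem. -/
theorem sub_min_le_bregman_local (hσ : 0 < σ) (hf : IsStronglyMonotoneSmooth σ L f)
    (hF : IsStronglyMonotoneSmooth σ L F) (hs : IsSimilar (σ / 200) f F) (ho : gradient F o = 0)
    (hu : gradient f u = gradient f y - s) (x : Vec d) :
    F x - F o ≤ 1.2 * bregman f x u + 0.006 * (F y - F o)
      + 5 * (‖s - gradient F y‖ ^ 2 / σ) := by
  set g := ‖s - gradient F y‖ with hg
  have hg0 : 0 ≤ g := norm_nonneg _
  have hyo := hF.le_bregman y o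
  have hxo := hF.le_bregman x o
  rw [← sub_min_eq_bregman ho] at hyo hxo
  have hou : 0 ≤ bregman f o u := le_trans (by positivity) (hf.le_bregman o u)
  have h3 : F x - F o ≤ bregman f x u + σ / 400 * ‖x - o‖ ^ 2
      + (σ / 200 * ‖y - o‖) * ‖x - o‖ + g * ‖x - o‖ := by
    have h4 := abs_le.1 (hs.abs_bregman_sub_le hf.differentiable hF.differentiable x o)
    have h5 := (abs_le.1 (abs_real_inner_le_norm (s - gradient F y) (x - o))).1
    have h6 := (real_inner_le_norm ((gradient f y - gradient F y) - (gradient f o - gradient F o))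
      (x - o)).trans (mul_le_mul_of_nonneg_right (hs y o) (norm_nonneg _))
    -- Three-point identity. Dropping the nonnegative `bregman f o u` moves the reference point from
    -- `u` to the global minimizer `o`.
    have e : bregman f x u = bregman f o u + (f x - f o - inner ℝ (gradient f u) (x - o)) := by
      have : x - u = (o - u) + (x - o) := by abel
      rw [bregman, bregman, this, inner_add_right]; ring
    have e2 : gradient f u = ((gradient f y - gradient F y) - (gradient f o - gradient F o))
        + (gradient f o - gradient F o) - (s - gradient F y) := by rw [hu]; abel
    rw [e2, inner_sub_left, inner_add_left, inner_sub_left (gradient f o)] at e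
    rw [bregman, bregman] at h4
    rw [ho, inner_zero_left] at *
    linarith [h4.1]
  set a := ‖x - o‖
  set b := ‖y - o‖
  -- The weight `1/16` lets all multiples of `σ a²` be absorbed by `σ/2 · a² ≤ F x - F o`, at the
  -- cost of the factor `1.2`.
  have hG : g * a ≤ 4 * (g ^ 2 / σ) + σ * a ^ 2 / 16 := by
    have : 4 * (g ^ 2 / σ) + σ * a ^ 2 / 16 - g * a = (8 * g - σ * a) ^ 2 / (16 * σ) := by
      field_simp; ring
    have : 0 ≤ (8 * g - σ * a) ^ 2 / (16 * σ) := by positivity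
    linarith
  have hab : (σ / 200 * b) * a ≤ σ / 400 * (a ^ 2 + b ^ 2) := by
    have : 0 ≤ σ / 400 * (a - b) ^ 2 := by positivity
    linarith
  have hG0 : 0 ≤ g ^ 2 / σ := by positivity
  have hb0 : 0 ≤ σ * b ^ 2 := by positivity
  have ha0 : 0 ≤ σ * a ^ 2 := by positivity
  have : 0 ≤ bregman f x u := le_trans (by positivity) (hf.le_bregman x u)
  linarith

/-- `∇F(x)` is the surrogate's gradient minus the similarity increment and the tracking error.
Strong monotonicity bounds the increment by `(‖∇F x‖ + ‖∇F y‖)/200`, whose first part is absorbed on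
the left. -/
theorem sq_norm_gradient_le_local (hσ : 0 < σ)
    (hF : IsStronglyMonotoneSmooth σ L F) (hs : IsSimilar (σ / 200) f F) (ho : gradient F o = 0)
    (x : Vec d) :
    ‖gradient F x‖ ^ 2 ≤ 3.1 * (‖gradient f x + (s - gradient f y)‖ ^ 2
      + ‖gradient F y‖ ^ 2 / 40000 + ‖s - gradient F y‖ ^ 2) := by
  have e : gradient F x = (gradient f x + (s - gradient f y))
      - ((gradient f x - gradient F x) - (gradient f y - gradient F y)) - (s - gradient F y) := by
    abel
  have h1 : ‖gradient F x‖ ≤ ‖gradient f x + (s - gradient f y)‖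
      + σ / 200 * ‖x - y‖ + ‖s - gradient F y‖ := by
    have h2 := _root_.norm_sub_le ((gradient f x + (s - gradient f y))
      - ((gradient f x - gradient F x) - (gradient f y - gradient F y))) (s - gradient F y)
    rw [← e] at h2
    have h3 := _root_.norm_sub_le (gradient f x + (s - gradient f y))
      ((gradient f x - gradient F x) - (gradient f y - gradient F y))
    linarith [hs x y]
  have h2 : ‖x - y‖ ≤ ‖x - o‖ + ‖y - o‖ := by
    have := _root_.norm_sub_le (x - o) (y - o)
    rwa [sub_sub_sub_cancel_right] at this
  have h3 := hF.norm_sub_le x o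
  have h4 := hF.norm_sub_le y o
  rw [ho, sub_zero] at h3 h4
  have h5 := mul_le_mul_of_nonneg_left h2 hσ.le
  set N := ‖gradient F x‖
  set P := ‖gradient f x + (s - gradient f y)‖ with hP
  set M := ‖gradient F y‖
  set g := ‖s - gradient F y‖
  have h6 : 0.995 * N ≤ P + M / 200 + g := by linarith
  have h7 : (0.995 * N) ^ 2 ≤ (P + M / 200 + g) ^ 2 :=
    pow_le_pow_left₀ (by positivity) h6 2
  nlinarith [sq_nonneg (P - M / 200), sq_nonneg (P - g), sq_nonneg (M / 200 - g), sq_nonneg P,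
    sq_nonneg g, sq_nonneg M]

end LocalProblem

/-- The potential in which the inner loop contracts: the suboptimality for SVRG, and the scaled
squared gradient norm for SARAH. -/
def potential (alg : Variant) (σ : ℝ) (F : Vec d → ℝ) (o x : Vec d) : ℝ :=
  match alg with
  | .svrg => F x - F o
  | .sarah => ‖gradient F x‖ ^ 2 / σ

theorem le_potential (alg : Variant) (hσ : 0 < σ) {F : Vec d → ℝ}
    (hF : IsStronglyMonotoneSmooth σ L F) {o : Vec d} (ho : gradient F o = 0) (x : Vec d) :
    σ / 2 * ‖x - o‖ ^ 2 ≤ potential alg σ F o x := by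
  cases alg with
  | svrg =>
    simp only [potential]
    rw [sub_min_eq_bregman ho]
    exact hF.le_bregman x o
  | sarah =>
    simp only [potential]
    have h := hF.norm_sub_le x o
    rw [ho, sub_zero] at h
    rw [le_div_iff₀ hσ]
    have := pow_le_pow_left₀ (by positivity) h 2
    have : 0 ≤ (σ * ‖x - o‖) ^ 2 := by positivity
    linarith

/-- The inner loop contracts the potential in expectation, up to the gradient tracking error. -/
theorem sum_potential_innerLoop_le (alg : Variant) (hm : 0 < m) (hσ : 0 < σ) (hσL : σ ≤ L)
    (h : ∀ j i, IsConvexSmooth L (loss j i)) (j : Fin n) {F : Vec d → ℝ} {o : Vec d}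
    (hf : IsStronglyMonotoneSmooth σ L (localLoss loss j))
    (hF : IsStronglyMonotoneSmooth σ L F) (hs : IsSimilar (σ / 200) (localLoss loss j) F)
    (ho : gradient F o = 0) (hS : 1000000 * (L / σ) ≤ S) (y s : Vec d) :
    ∑ r : Fin S, ∑ z, potential alg σ F o (innerLoop alg (loss j) (1 / 1000 / L) y s z r.succ).1
      ≤ (m : ℝ) ^ S * S * (1 / 20 * potential alg σ F o y
        + 10 * (‖s - gradient F y‖ ^ 2 / σ)) := by
  have hL : 0 < L := hσ.trans_le hσL
  set δ := 1 / 1000 / L with hδdef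
  have hδ : 0 < δ := by positivity
  have hLδ : L * δ = 1 / 1000 := by rw [hδdef]; field_simp
  have hm' : (0 : ℝ) < m := by exact_mod_cast hm
  -- Here `S ≥ 10⁶ κ` enters: the initial error, of order `1/σ`, becomes negligible against `δ S`;
  -- the accumulated variance is small because `Lδ = 1/1000`.
  have hSδ : 1 / σ ≤ 0.001 * (δ * S) := by
    have h1 := mul_le_mul_of_nonneg_left hS hδ.le
    have h2 : δ * (1000000 * (L / σ)) = 1000 * (1 / σ) := by
      rw [show δ * (1000000 * (L / σ)) = 1000000 * (L * δ) * (1 / σ) by ring, hLδ]; ring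
    linarith
  have hGy : 0 ≤ ‖s - gradient F y‖ ^ 2 / σ := by positivity
  have hpy : 0 ≤ potential alg σ F o y := le_trans (by positivity) (le_potential alg hσ hF ho y)
  have hcard : ∀ t : ℝ, ∑ _r : Fin S, ∑ _z : Fin S → Fin m, t = (m : ℝ) ^ S * S * t := by
    intro t; simp; ring
  have hmS : 0 ≤ (m : ℝ) ^ S * S := by positivity
  set f := localLoss loss j with hfdef
  set I := innerLoop (S := S) alg (loss j) δ y s with hI
  cases alg with
  | svrg =>
    -- `u` solves the surrogate problem, whose gradient is `∇f - ∇f(y) + s`.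
    obtain ⟨u, hu⟩ := hf.exists_gradient_eq hσ (gradient f y - s)
    have hsu : s = gradient f y - gradient f u := by rw [hu]; abel
    have h1 := sum_bregman_svrg_le (S := S) hm hL hσ hδ (by rw [hLδ]; norm_num) h j hf hsu
    have h2 := bregman_local_le hσ hf hF hs ho hu
    have hb0 : 0 ≤ bregman f y u := le_trans (by positivity) (hf.le_bregman y u)
    have h3 : ∑ r : Fin S, ∑ z, bregman f (I z r.succ).1 u
        ≤ (m : ℝ) ^ S * S * (1 / 200 * bregman f y u) := by
      have h4 : (2 / σ + 4 * δ ^ 2 * L * S) * bregman f y u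
          ≤ (2 * δ * (1 - 2 * L * δ)) * (S * (1 / 200 * bregman f y u)) := by
        have e1 : 2 / σ + 4 * δ ^ 2 * L * S ≤ 0.006 * (δ * S) := by
          have : 4 * δ ^ 2 * L * S = 4 * (L * δ) * (δ * S) := by ring
          rw [this, hLδ]
          have : 2 / σ = 2 * (1 / σ) := by ring
          linarith
        have e2 : 2 * δ * (1 - 2 * L * δ) = 1.996 * δ := by
          rw [mul_assoc 2 L δ, hLδ]; ring
        rw [e2]
        have e3 := mul_le_mul_of_nonneg_right e1 hb0
        have e4 : 0 ≤ δ * S * bregman f y u := by positivity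
        linarith
      have h5 := h1.trans (mul_le_mul_of_nonneg_left h4 (by positivity : (0 : ℝ) ≤ (m : ℝ) ^ S))
      have e2 : 0 < 2 * δ * (1 - 2 * L * δ) := by
        rw [mul_assoc 2 L δ, hLδ]
        norm_num
        exact hδ
      refine le_of_mul_le_mul_left (h5.trans (le_of_eq ?_)) e2
      ring
    calc ∑ r : Fin S, ∑ z, potential .svrg σ F o (I z r.succ).1
        ≤ ∑ r : Fin S, ∑ z, (1.2 * bregman f (I z r.succ).1 u + (0.006 * (F y - F o)
            + 5 * (‖s - gradient F y‖ ^ 2 / σ))) :=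
          Finset.sum_le_sum fun r _ => Finset.sum_le_sum fun z _ => by
            have := sub_min_le_bregman_local hσ hf hF hs ho hu (I z r.succ).1
            simp only [potential]
            linarith
      _ = 1.2 * ∑ r : Fin S, ∑ z, bregman f (I z r.succ).1 u + (m : ℝ) ^ S * S *
            (0.006 * (F y - F o) + 5 * (‖s - gradient F y‖ ^ 2 / σ)) := by
          rw [← hcard]
          simp only [Finset.sum_add_distrib, Finset.mul_sum]
      _ ≤ 1.2 * ((m : ℝ) ^ S * S * (1 / 200 * bregman f y u)) + (m : ℝ) ^ S * S *
            (0.006 * (F y - F o) + 5 * (‖s - gradient F y‖ ^ 2 / σ)) := by linarith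
      _ = (m : ℝ) ^ S * S * (0.006 * bregman f y u + 0.006 * (F y - F o)
            + 5 * (‖s - gradient F y‖ ^ 2 / σ)) := by ring
      _ ≤ _ := by
          refine mul_le_mul_of_nonneg_left ?_ hmS
          simp only [potential] at hpy ⊢
          linarith
  | sarah =>
    have hsp : s = gradient f y + (s - gradient f y) := by abel
    have h1 := sum_sq_norm_gradient_sarah_le (S := S) hm hL hσ hδ (by rw [hLδ]; norm_num) h j hf hsp
    have h3 : ∑ r : Fin S, ∑ z, ‖gradient f (I z r.succ).1 + (s - gradient f y)‖ ^ 2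
        ≤ (m : ℝ) ^ S * S * (1 / 500 * ‖s‖ ^ 2) := by
      have h4 : (1 / σ + δ * (L * δ) * S) * ‖s‖ ^ 2 ≤ δ * (S * (1 / 500 * ‖s‖ ^ 2)) := by
        rw [hLδ]
        have e1 : 1 / σ + δ * (1 / 1000) * S ≤ 0.002 * (δ * S) := by linarith
        have e3 := mul_le_mul_of_nonneg_right e1 (sq_nonneg ‖s‖)
        linarith
      have h5 := h1.trans (mul_le_mul_of_nonneg_left h4 (by positivity : (0 : ℝ) ≤ (m : ℝ) ^ S))
      refine le_of_mul_le_mul_left (h5.trans (le_of_eq ?_)) hδ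
      ring
    have h6 : ‖s‖ ^ 2 ≤ 2 * (‖gradient F y‖ ^ 2 + ‖s - gradient F y‖ ^ 2) := by
      have := sq_norm_add_le (gradient F y) (s - gradient F y)
      rwa [add_sub_cancel] at this
    simp only [potential, ← Finset.sum_div]
    rw [div_le_iff₀ hσ]
    calc ∑ r : Fin S, ∑ z, ‖gradient F (I z r.succ).1‖ ^ 2
        ≤ ∑ r : Fin S, ∑ z, (3.1 * ‖gradient f (I z r.succ).1 + (s - gradient f y)‖ ^ 2
            + 3.1 * (‖gradient F y‖ ^ 2 / 40000 + ‖s - gradient F y‖ ^ 2)) :=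
          Finset.sum_le_sum fun r _ => Finset.sum_le_sum fun z _ => by
            have := sq_norm_gradient_le_local (y := y) (s := s) hσ hF hs ho (I z r.succ).1
            linarith
      _ = 3.1 * ∑ r : Fin S, ∑ z, ‖gradient f (I z r.succ).1 + (s - gradient f y)‖ ^ 2
            + (m : ℝ) ^ S * S *
              (3.1 * (‖gradient F y‖ ^ 2 / 40000 + ‖s - gradient F y‖ ^ 2)) := by
          rw [← hcard]
          simp only [Finset.sum_add_distrib, Finset.mul_sum]
      _ ≤ 3.1 * ((m : ℝ) ^ S * S * (1 / 500 * ‖s‖ ^ 2)) + (m : ℝ) ^ S * S *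
              (3.1 * (‖gradient F y‖ ^ 2 / 40000 + ‖s - gradient F y‖ ^ 2)) := by linarith
      _ = (m : ℝ) ^ S * S * (3.1 * (1 / 500 * ‖s‖ ^ 2) +
              3.1 * (‖gradient F y‖ ^ 2 / 40000 + ‖s - gradient F y‖ ^ 2)) := by ring
      _ ≤ (m : ℝ) ^ S * S * (1 / 20 * ‖gradient F y‖ ^ 2 + 10 * ‖s - gradient F y‖ ^ 2) := by
          refine mul_le_mul_of_nonneg_left ?_ hmS
          nlinarith [sq_nonneg ‖gradient F y‖, sq_nonneg ‖s - gradient F y‖]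
      _ = _ := by field_simp

end

/-! ### Mixing and gradient tracking -/

section

variable {n m d S : ℕ} {loss : Fin n → Fin m → Vec d → ℝ} {σ L : ℝ}

section Network

theorem sum_eq_smul_average (hn : 0 < n) (q : Fin n → Vec d) : ∑ j, q j = (n : ℝ) • average q := by
  have hn' : (n : ℝ) ≠ 0 := by exact_mod_cast hn.ne'
  rw [average, smul_smul, mul_inv_cancel₀ hn', one_smul]

/-- The squared distance of a stacked vector to consensus. -/
def dispersion (q : Fin n → Vec d) : ℝ := ∑ j, ‖q j - average q‖ ^ 2

theorem dispersion_nonneg (q : Fin n → Vec d) : 0 ≤ dispersion q :=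
  Finset.sum_nonneg fun _ _ => sq_nonneg _

theorem average_sub_const (hn : 0 < n) (q : Fin n → Vec d) (p : Vec d) :
    average (fun j => q j - p) = average q - p := by
  have hn' : (n : ℝ) ≠ 0 := by exact_mod_cast hn.ne'
  rw [average, Finset.sum_sub_distrib, smul_sub]
  simp [average, ← Nat.cast_smul_eq_nsmul ℝ, smul_smul, hn']

theorem mul_sq_norm_average_add_dispersion (hn : 0 < n) (q : Fin n → Vec d) :
    n * ‖average q‖ ^ 2 + dispersion q = ∑ j, ‖q j‖ ^ 2 := by
  rw [dispersion, sum_sq_norm_sub_mean (by rw [sum_eq_smul_average hn, Fintype.card_fin]),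
    Fintype.card_fin]
  ring

theorem mul_sq_norm_average_le (hn : 0 < n) (q : Fin n → Vec d) :
    n * ‖average q‖ ^ 2 ≤ ∑ j, ‖q j‖ ^ 2 := by
  linarith [mul_sq_norm_average_add_dispersion hn q, dispersion_nonneg q]

theorem dispersion_le (hn : 0 < n) (q : Fin n → Vec d) (p : Vec d) :
    dispersion q ≤ ∑ j, ‖q j - p‖ ^ 2 := by
  rw [← mul_sq_norm_average_add_dispersion hn fun j => q j - p, dispersion, dispersion,
    average_sub_const hn]
  simp only [sub_sub_sub_cancel_right]
  have : 0 ≤ (n : ℝ) * ‖average q - p‖ ^ 2 := by positivity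
  linarith

theorem average_mix {W : Matrix (Fin n) (Fin n) ℝ} (hW : ∀ j, ∑ i, W i j = 1)
    (q : Fin n → Vec d) : average (mix W q) = average q := by
  simp only [average, mix]
  rw [Finset.sum_comm]
  simp only [← Finset.sum_smul, hW, one_smul]

/-- The operator norm on `ℝⁿ` is applied to each of the `d` coordinates separately. -/
theorem sum_sq_norm_mix_le (A : Matrix (Fin n) (Fin n) ℝ) (q : Fin n → Vec d) :
    ∑ j, ‖mix A q j‖ ^ 2 ≤
      ‖Matrix.toEuclideanCLM (n := Fin n) (𝕜 := ℝ) A‖ ^ 2 * ∑ j, ‖q j‖ ^ 2 := by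
  simp only [EuclideanSpace.norm_sq_eq]
  rw [Finset.sum_comm, Finset.sum_comm (s := Finset.univ (α := Fin n)), Finset.mul_sum]
  refine Finset.sum_le_sum fun l _ => ?_
  have h := (Matrix.toEuclideanCLM (n := Fin n) (𝕜 := ℝ) A).le_opNorm
    (WithLp.toLp 2 fun i => q i l)
  have h2 := pow_le_pow_left₀ (norm_nonneg _) h 2
  rw [mul_pow, EuclideanSpace.norm_sq_eq, EuclideanSpace.norm_sq_eq] at h2
  simpa [mix, Matrix.mulVec, dotProduct] using h2

/-- Unit column sums preserve the average and unit row sums fix constant stacks, so on deviations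
from the average `W` acts as `W - (1/n) 1 1ᵀ`. -/
theorem dispersion_mix_le (hn : 0 < n) {W : Matrix (Fin n) (Fin n) ℝ}
    (hr : ∀ i, ∑ j, W i j = 1) (hc : ∀ j, ∑ i, W i j = 1) (q : Fin n → Vec d) :
    dispersion (mix W q) ≤ mixingRate W ^ 2 * dispersion q := by
  have h := sum_sq_norm_mix_le (W - Matrix.of fun _ _ => (n : ℝ)⁻¹) fun j => q j - average q
  refine le_trans (le_of_eq (Finset.sum_congr rfl fun j _ => ?_)) h
  congr 2
  have h0 : ∑ i, (q i - average q) = 0 := by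
    rw [sum_eq_smul_average hn, average_sub_const hn, sub_self, smul_zero]
  rw [average_mix hc]
  simp only [mix, Matrix.sub_apply, Matrix.of_apply, sub_smul, Finset.sum_sub_distrib]
  rw [← Finset.smul_sum, h0, smul_zero, sub_zero]
  simp only [smul_sub, Finset.sum_sub_distrib, ← Finset.sum_smul, hr, one_smul]

theorem average_mix_iterate {W : Matrix (Fin n) (Fin n) ℝ} (hc : ∀ j, ∑ i, W i j = 1) (K : ℕ)
    (q : Fin n → Vec d) : average ((mix W)^[K] q) = average q := by
  induction K with
  | zero => rfl
  | succ K ih => rw [Function.iterate_succ_apply', average_mix hc, ih]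

theorem dispersion_mix_iterate_le (hn : 0 < n) {W : Matrix (Fin n) (Fin n) ℝ}
    (hr : ∀ i, ∑ j, W i j = 1) (hc : ∀ j, ∑ i, W i j = 1) (K : ℕ) (q : Fin n → Vec d) :
    dispersion ((mix W)^[K] q) ≤ (mixingRate W ^ K) ^ 2 * dispersion q := by
  induction K with
  | zero => simp
  | succ K ih =>
    rw [Function.iterate_succ_apply']
    refine (dispersion_mix_le hn hr hc _).trans ?_
    refine (mul_le_mul_of_nonneg_left ih (sq_nonneg _)).trans (le_of_eq ?_)
    ring

theorem exchange_iterate (W : Matrix (Fin n) (Fin n) ℝ) (K : ℕ) (q : Message n d) :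
    (Message.exchange W)^[K] q = ⟨(mix W)^[K] q.y, (mix W)^[K] q.s, q.rounds + K⟩ := by
  induction K with
  | zero => rfl
  | succ K ih =>
    simp only [Function.iterate_succ_apply', ih, Message.exchange, add_assoc]

end Network

/-- The standing assumptions, in the form in which the analysis uses them. -/
structure IsRegular (loss : Fin n → Fin m → Vec d → ℝ) (σ L : ℝ) (o : Vec d) : Prop where
  agents_pos : 0 < n
  samples_pos : 0 < m
  pos : 0 < σ
  le : σ ≤ L
  convexSmooth : ∀ j i, IsConvexSmooth L (loss j i)
  localLoss : ∀ j, IsStronglyMonotoneSmooth σ L (localLoss loss j)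
  similar : ∀ j, IsSimilar (σ / 200) (NetVR.localLoss loss j) (globalLoss loss)
  minimizer : gradient (globalLoss loss) o = 0

theorem IsRegular.globalLoss {o : Vec d} (h : IsRegular loss σ L o) :
    IsStronglyMonotoneSmooth σ L (globalLoss loss) :=
  isStronglyMonotoneSmooth_globalLoss h.agents_pos h.localLoss

theorem IsRegular.gradient_globalLoss {o : Vec d} (h : IsRegular loss σ L o) (x : Vec d) :
    gradient (NetVR.globalLoss loss) x = average fun j => gradient (NetVR.localLoss loss j) x :=
  NetVR.gradient_globalLoss (fun j => (h.localLoss j).differentiable) x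

/-- The gradient tracking error after one iteration. -/
theorem sum_sq_norm_tracking_le {o : Vec d} (h : IsRegular loss σ L o) {a : ℝ}
    {y s y' z : Fin n → Vec d}
    (hs : average s = average fun j => gradient (localLoss loss j) (y j))
    (hz : average z = average s) (hzd : dispersion z ≤ a ^ 2 * dispersion s) :
    ∑ j, ‖(z j + gradient (localLoss loss j) (y' j) - gradient (localLoss loss j) (y j))
        - gradient (globalLoss loss) (y' j)‖ ^ 2
      ≤ 8 * a ^ 2 * ∑ j, ‖s j - gradient (globalLoss loss) (y j)‖ ^ 2
        + (8 * a ^ 2 + 8) * (L ^ 2 * dispersion y)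
        + 8 * (σ / 200) ^ 2 * (∑ j, ‖y' j - o‖ ^ 2 + ∑ j, ‖y j - o‖ ^ 2) := by
  set F := globalLoss loss with hF
  set f := localLoss loss with hf
  set yb := average y with hyb
  have hn := h.agents_pos
  have hlip : ∀ {g : Vec d → ℝ}, IsStronglyMonotoneSmooth σ L g → ∀ x y,
      ‖gradient g x - gradient g y‖ ^ 2 ≤ L ^ 2 * ‖x - y‖ ^ 2 := fun hg x y => by
    rw [← mul_pow]
    exact pow_le_pow_left₀ (norm_nonneg _) (hg.lipschitz x y) 2
  have hgrad : ∑ j, ‖gradient F yb - gradient F (y j)‖ ^ 2 ≤ L ^ 2 * dispersion y := by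
    rw [dispersion, Finset.mul_sum]
    refine Finset.sum_le_sum fun j _ => ?_
    rw [norm_sub_rev]
    exact hlip h.globalLoss _ _
  -- By tracking, `average s` is the mean of `∇f_j(y_j)`, while `∇F(ȳ)` is the mean of `∇f_j(ȳ)`.
  have hmean : n * ‖average s - gradient F yb‖ ^ 2 ≤ L ^ 2 * dispersion y := by
    have e : average s - gradient F yb =
        average fun j => gradient (f j) (y j) - gradient (f j) yb := by
      rw [hs, h.gradient_globalLoss]
      simp only [average, Finset.sum_sub_distrib, smul_sub, hf]
    rw [e, dispersion, Finset.mul_sum]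
    exact (mul_sq_norm_average_le hn _).trans
      (Finset.sum_le_sum fun j _ => hlip (h.localLoss j) _ _)
  have hdisp : dispersion s ≤ 2 * ∑ j, ‖s j - gradient F (y j)‖ ^ 2
      + 2 * (L ^ 2 * dispersion y) := by
    refine (dispersion_le hn s (gradient F yb)).trans ?_
    have h1 : ∀ j, ‖s j - gradient F yb‖ ^ 2 ≤ 2 * (‖s j - gradient F (y j)‖ ^ 2
        + ‖gradient F yb - gradient F (y j)‖ ^ 2) := fun j => by
      have := sq_norm_sub_le (s j - gradient F (y j)) (gradient F yb - gradient F (y j))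
      rwa [sub_sub_sub_cancel_right] at this
    have h2 := Finset.sum_le_sum fun j (_ : j ∈ Finset.univ) => h1 j
    rw [← Finset.mul_sum, Finset.sum_add_distrib] at h2
    linarith
  set D : Fin n → Vec d := fun j =>
    (gradient (f j) (y' j) - gradient F (y' j)) - (gradient (f j) (y j) - gradient F (y j)) with hD
  have hDsum : ∑ j, ‖D j‖ ^ 2 ≤
      (σ / 200) ^ 2 * (2 * (∑ j, ‖y' j - o‖ ^ 2 + ∑ j, ‖y j - o‖ ^ 2)) := by
    rw [← Finset.sum_add_distrib, Finset.mul_sum, Finset.mul_sum]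
    refine Finset.sum_le_sum fun j _ => ?_
    have h1 := pow_le_pow_left₀ (norm_nonneg _) (h.similar j (y' j) (y j)) 2
    rw [mul_pow] at h1
    refine h1.trans (mul_le_mul_of_nonneg_left ?_ (sq_nonneg _))
    have := sq_norm_sub_le (y' j - o) (y j - o)
    rwa [sub_sub_sub_cancel_right] at this
  have hterm : ∀ j, ‖(z j + gradient (f j) (y' j) - gradient (f j) (y j))
        - gradient F (y' j)‖ ^ 2 ≤ 4 * (‖z j - average z‖ ^ 2 + ‖average s - gradient F yb‖ ^ 2
          + ‖gradient F yb - gradient F (y j)‖ ^ 2 + ‖D j‖ ^ 2) := fun j => by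
    -- Four errors: disagreement of the gradient estimates left after mixing, local gradients
    -- averaged at scattered points, the scatter of `y` itself, and the change of `∇f_j - ∇F` from
    -- `y_j` to `y'_j`.
    have e : (z j + gradient (f j) (y' j) - gradient (f j) (y j)) - gradient F (y' j)
        = ((z j - average z) + (average s - gradient F yb))
          + ((gradient F yb - gradient F (y j)) + D j) := by
      rw [hz]; simp only [hD]; abel
    rw [e]
    refine (sq_norm_add_le _ _).trans ?_
    have h1 := sq_norm_add_le (z j - average z) (average s - gradient F yb)
    have h2 := sq_norm_add_le (gradient F yb - gradient F (y j)) (D j)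
    linarith
  have hsum := Finset.sum_le_sum fun j (_ : j ∈ Finset.univ) => hterm j
  simp only [← Finset.mul_sum, Finset.sum_add_distrib, Finset.sum_const, Finset.card_univ,
    Fintype.card_fin, nsmul_eq_mul] at hsum
  have h5 := mul_le_mul_of_nonneg_left hdisp (sq_nonneg a)
  have e : ∑ j, ‖z j - average z‖ ^ 2 = dispersion z := rfl
  rw [e] at hsum
  linarith

section Potential

/-- A quadratic function has an affine gradient. -/
theorem IsQuadratic.exists_gradient_eq {g : Vec d → ℝ} (hg : IsQuadratic g) :
    ∃ (H : Vec d →L[ℝ] Vec d) (b : Vec d), ∀ x, gradient g x = H x + b := by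
  obtain ⟨H, b, c, hH, hgx⟩ := hg
  refine ⟨H, b, fun x => ?_⟩
  have h1 : HasFDerivAt g (innerSL ℝ (H x + b)) x := by
    have h2 : HasFDerivAt (fun x => inner ℝ (H x) x) _ x := H.hasFDerivAt.inner ℝ (hasFDerivAt_id x)
    have h3 := ((h2.const_mul (1 / 2)).add (innerSL ℝ b).hasFDerivAt).add_const c
    refine (h3.congr_fderiv ?_).congr_of_eventuallyEq (Filter.Eventually.of_forall hgx)
    ext v
    have : inner ℝ (H v) x = inner ℝ (H x) v := by
      rw [hH.inner_left_eq_inner_right, real_inner_comm]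
    simp [this]
    ring
  refine HasGradientAt.gradient ?_
  rw [hasGradientAt_iff_hasFDerivAt]
  exact h1

/-- Affine gradients commute with averaging. This is where SARAH needs quadratic losses. -/
theorem gradient_globalLoss_average {o : Vec d} (h : IsRegular loss σ L o)
    (hq : ∀ j, IsQuadratic (localLoss loss j)) (q : Fin n → Vec d) :
    gradient (globalLoss loss) (average q) =
      average fun j => gradient (globalLoss loss) (q j) := by
  choose H b hHb using fun j => (hq j).exists_gradient_eq
  have hn' : (n : ℝ) ≠ 0 := by exact_mod_cast h.agents_pos.ne'
  have haff : ∀ x, gradient (globalLoss loss) x =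
      ((n : ℝ)⁻¹ • ∑ j, H j) x + average b := fun x => by
    rw [h.gradient_globalLoss]
    simp [average, hHb, Finset.sum_add_distrib]
  simp only [haff]
  generalize (n : ℝ)⁻¹ • ∑ j, H j = A
  simp [average, Finset.sum_add_distrib, smul_smul, ← Nat.cast_smul_eq_nsmul ℝ, hn']

/-- Mixing does not increase the total potential by more than the remaining dispersion. -/
theorem sum_potential_le_of_average_eq (alg : Variant) {o : Vec d} (h : IsRegular loss σ L o)
    (hq : alg = .sarah → ∀ j, IsQuadratic (localLoss loss j)) {x y : Fin n → Vec d}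
    (hxy : average y = average x) :
    ∑ j, potential alg σ (globalLoss loss) o (y j) ≤
      ∑ j, potential alg σ (globalLoss loss) o (x j) + L ^ 2 / σ * dispersion y := by
  have hn := h.agents_pos
  have hσ := h.pos
  have hF := h.globalLoss
  set F := globalLoss loss
  cases alg with
  | svrg =>
    -- The Bregman divergences about the average sum to `∑ F(q_j) - n F(q̄)`: bounded by dispersion
    -- after mixing, nonnegative before it, with the same `q̄`.
    have hup : ∑ j, bregman F (y j) (average y) ≤ L ^ 2 / σ * dispersion y := by
      rw [dispersion, Finset.mul_sum]
      refine Finset.sum_le_sum fun j _ => (hF.bregman_le _ _).trans ?_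
      refine mul_le_mul_of_nonneg_right ?_ (sq_nonneg _)
      rw [le_div_iff₀ hσ]
      have := h.le
      nlinarith
    have hlow : 0 ≤ ∑ j, bregman F (x j) (average x) :=
      Finset.sum_nonneg fun j _ => le_trans (by positivity) (hF.le_bregman _ _)
    have hlin : ∀ q : Fin n → Vec d, ∑ j, bregman F (q j) (average q)
        = ∑ j, F (q j) - n * F (average q) := fun q => by
      simp only [bregman, Finset.sum_sub_distrib, ← inner_sum]
      rw [sum_eq_smul_average hn]
      simp [← Nat.cast_smul_eq_nsmul ℝ]
    rw [hlin] at hup hlow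
    rw [hxy] at hup
    simp only [potential, Finset.sum_sub_distrib]
    linarith
  | sarah =>
    have hav := gradient_globalLoss_average h (hq rfl)
    simp only [potential, ← Finset.sum_div]
    rw [div_mul_eq_mul_div, ← add_div]
    refine div_le_div_of_nonneg_right ?_ hσ.le
    -- The mean gradient equals `∇F` at the average, which mixing does not move; only the dispersion
    -- of the gradients is new.
    have h1 := mul_sq_norm_average_add_dispersion hn fun j => gradient F (y j)
    rw [← hav, hxy, hav] at h1
    have h2 := mul_sq_norm_average_le hn fun j => gradient F (x j)
    have h3 : (dispersion fun j => gradient F (y j)) ≤ L ^ 2 * dispersion y := by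
      rw [dispersion, ← hav, dispersion, Finset.mul_sum]
      refine Finset.sum_le_sum fun j _ => ?_
      rw [← mul_pow]
      exact pow_le_pow_left₀ (norm_nonneg _) (hF.lipschitz _ _) 2
    linarith

end Potential

end

/-! ### The Lyapunov function -/

section

variable {n m d S : ℕ} {loss : Fin n → Fin m → Vec d → ℝ} {σ L : ℝ}

section Iteration

/-- The parameter estimates after the communication rounds of an iteration. -/
def nextY (W : Matrix (Fin n) (Fin n) ℝ) (K : ℕ) (st : State n d) : Fin n → Vec d :=
  (mix W)^[K] st.x

/-- The gradient estimates after the communication rounds of an iteration. -/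
def nextS (loss : Fin n → Fin m → Vec d → ℝ) (W : Matrix (Fin n) (Fin n) ℝ) (K : ℕ)
    (st : State n d) : Fin n → Vec d := fun j =>
  (mix W)^[K] st.s j + gradient (localLoss loss j) (nextY W K st j)
    - gradient (localLoss loss j) (st.y j)

theorem iterate_eq (alg : Variant) (W : Matrix (Fin n) (Fin n) ℝ) (K : ℕ) (δ : ℝ)
    (seed : Fin n → Seed m S) (st : State n d) :
    iterate alg loss W K δ seed st =
      { x := fun j => (innerLoop alg (loss j) δ (nextY W K st j) (nextS loss W K st j)
          (seed j).1 (seed j).2.succ).1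
        y := nextY W K st
        s := nextS loss W K st
        rounds := st.rounds + K } := by
  simp only [iterate, exchange_iterate]
  rfl

theorem run_rounds (alg : Variant) (W : Matrix (Fin n) (Fin n) ℝ) (K : ℕ) (δ : ℝ)
    (x₀ : Fin n → Vec d) (seed : ℕ × Fin n → Seed m S) (t : ℕ) :
    (run alg loss W K δ x₀ seed t).rounds = t * K := by
  induction t with
  | zero => simp [run, initialState]
  | succ t ih => rw [run, iterate_eq, ih]; ring

theorem run_congr (alg : Variant) (W : Matrix (Fin n) (Fin n) ℝ) (K : ℕ) (δ : ℝ)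
    (x₀ : Fin n → Vec d) {seed seed' : ℕ × Fin n → Seed m S} {t : ℕ}
    (h : ∀ p, p.1 < t → seed p = seed' p) :
    run alg loss W K δ x₀ seed t = run alg loss W K δ x₀ seed' t := by
  induction t with
  | zero => rfl
  | succ t ih =>
    rw [run, run, ih fun p hp => h p (hp.trans t.lt_succ_self)]
    congr 1
    exact funext fun j => h (t, j) t.lt_succ_self

/-- The gradient estimates track the average of the local gradients. -/
def IsTracking (loss : Fin n → Fin m → Vec d → ℝ) (y s : Fin n → Vec d) : Prop :=
  average s = average fun j => gradient (localLoss loss j) (y j)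

theorem IsTracking.next {W : Matrix (Fin n) (Fin n) ℝ} (hc : ∀ j, ∑ i, W i j = 1) (K : ℕ)
    {st : State n d} (h : IsTracking loss st.y st.s) :
    IsTracking loss (nextY W K st) (nextS loss W K st) := by
  have h1 := average_mix_iterate hc K st.s
  rw [h] at h1
  simp only [IsTracking, average, nextS] at h1 ⊢
  rw [Finset.sum_sub_distrib, Finset.sum_add_distrib, smul_sub, smul_add, h1]
  abel

theorem isTracking_run (alg : Variant) {W : Matrix (Fin n) (Fin n) ℝ} (hc : ∀ j, ∑ i, W i j = 1)
    (K : ℕ) (δ : ℝ) (x₀ : Fin n → Vec d) (seed : ℕ × Fin n → Seed m S) (t : ℕ) :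
    IsTracking loss (run alg loss W K δ x₀ seed t).y (run alg loss W K δ x₀ seed t).s := by
  induction t with
  | zero => rfl
  | succ t ih =>
    rw [run, iterate_eq]
    exact ih.next hc K

end Iteration

section Lyapunov

/-- The total potential of a stacked vector. -/
def totalPotential (alg : Variant) (loss : Fin n → Fin m → Vec d → ℝ) (σ : ℝ) (o : Vec d)
    (q : Fin n → Vec d) : ℝ := ∑ j, potential alg σ (globalLoss loss) o (q j)

/-- The squared gradient estimation error. -/
def trackingError (loss : Fin n → Fin m → Vec d → ℝ) (y s : Fin n → Vec d) : ℝ :=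
  ∑ j, ‖s j - gradient (globalLoss loss) (y j)‖ ^ 2

/-- The part of the Lyapunov function that the inner loops do not touch. -/
def networkLyapunov (alg : Variant) (loss : Fin n → Fin m → Vec d → ℝ) (σ L : ℝ) (o : Vec d)
    (y s : Fin n → Vec d) : ℝ :=
  totalPotential alg loss σ o y + 1000 * (L ^ 2 / σ * dispersion y)
    + 10 * (trackingError loss y s / σ)

/-- The Lyapunov function. -/
def lyapunov (alg : Variant) (loss : Fin n → Fin m → Vec d → ℝ) (σ L : ℝ) (o : Vec d)
    (st : State n d) : ℝ :=
  4 * totalPotential alg loss σ o st.x + networkLyapunov alg loss σ L o st.y st.s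

variable {o : Vec d}

theorem mul_sum_sq_norm_sub_le (h : IsRegular loss σ L o) (alg : Variant) (q : Fin n → Vec d) :
    σ / 2 * ∑ j, ‖q j - o‖ ^ 2 ≤ totalPotential alg loss σ o q := by
  rw [totalPotential, Finset.mul_sum]
  exact Finset.sum_le_sum fun j _ => le_potential alg h.pos h.globalLoss h.minimizer _

theorem totalPotential_nonneg (h : IsRegular loss σ L o) (alg : Variant) (q : Fin n → Vec d) :
    0 ≤ totalPotential alg loss σ o q := by
  have := h.pos
  exact le_trans (by positivity) (mul_sum_sq_norm_sub_le h alg q)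

theorem trackingError_nonneg (loss : Fin n → Fin m → Vec d → ℝ) (y s : Fin n → Vec d) :
    0 ≤ trackingError loss y s :=
  Finset.sum_nonneg fun _ _ => sq_nonneg _

/-- The communication rounds reduce the Lyapunov function, with some room for the inner loops. -/
theorem networkLyapunov_next_le (h : IsRegular loss σ L o) (alg : Variant)
    (hq : alg = .sarah → ∀ j, IsQuadratic (localLoss loss j))
    {W : Matrix (Fin n) (Fin n) ℝ} (hr : ∀ i, ∑ j, W i j = 1) (hc : ∀ j, ∑ i, W i j = 1) {K : ℕ}
    (hK : mixingRate W ^ K ≤ 1 / 100 / (L / σ)) {st : State n d}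
    (hst : IsTracking loss st.y st.s) :
    4 * (1 / 20 * totalPotential alg loss σ o (nextY W K st)
        + 10 * (trackingError loss (nextY W K st) (nextS loss W K st) / σ))
      + networkLyapunov alg loss σ L o (nextY W K st) (nextS loss W K st)
      ≤ 1 / 2 * lyapunov alg loss σ L o st := by
  have hσ := h.pos
  have hL : 0 < L := hσ.trans_le h.le
  have hn := h.agents_pos
  set a := mixingRate W ^ K with ha
  have ha0 : 0 ≤ a := pow_nonneg (norm_nonneg _) _
  set y' := nextY W K st with hy'
  set s' := nextS loss W K st with hs'
  set V := totalPotential alg loss σ o with hV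
  have haL : a * L ≤ σ / 100 := by
    have := mul_le_mul_of_nonneg_right hK hL.le
    have e : 1 / 100 / (L / σ) * L = σ / 100 := by field_simp
    linarith
  have ha100 : a ≤ 1 / 100 := by
    have h1 : a * σ ≤ a * L := mul_le_mul_of_nonneg_left h.le ha0
    have : a * σ ≤ 1 / 100 * σ := by linarith
    exact le_of_mul_le_mul_right this hσ
  have ha2 : a ^ 2 ≤ 1 / 10000 := by nlinarith
  -- `a L ≤ σ/100` cancels the condition number: `(aL)²/σ ≤ σ/10⁴`, and `σ/2` times the squared
  -- distances is at most the potential.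
  have hM : L ^ 2 / σ * dispersion y' ≤ V st.x / 5000 := by
    have h1 := dispersion_mix_iterate_le hn hr hc K st.x
    have h2 := dispersion_le hn st.x o
    have h3 := mul_sum_sq_norm_sub_le h alg st.x
    have h4 : (a * L) ^ 2 ≤ (σ / 100) ^ 2 := pow_le_pow_left₀ (by positivity) haL 2
    have h5 : L ^ 2 * dispersion y' ≤ (σ / 100) ^ 2 * ∑ j, ‖st.x j - o‖ ^ 2 := by
      calc L ^ 2 * dispersion y' ≤ L ^ 2 * (a ^ 2 * dispersion st.x) :=
            mul_le_mul_of_nonneg_left h1 (sq_nonneg _)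
        _ = (a * L) ^ 2 * dispersion st.x := by ring
        _ ≤ _ := mul_le_mul h4 h2 (dispersion_nonneg _) (sq_nonneg _)
    rw [div_mul_eq_mul_div, div_le_iff₀ hσ]
    have h6 := mul_le_mul_of_nonneg_left h3 hσ.le
    linarith
  have hVy : V y' ≤ V st.x + L ^ 2 / σ * dispersion y' :=
    sum_potential_le_of_average_eq alg h hq (average_mix_iterate hc K st.x)
  have hG : trackingError loss y' s' / σ ≤ 0.0008 * (trackingError loss st.y st.s / σ)
      + 9 * (L ^ 2 / σ * dispersion st.y) + 0.0004 * (V y' + V st.y) := by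
    have h1 := sum_sq_norm_tracking_le h (a := a) (y' := y') (z := (mix W)^[K] st.s) hst
      (average_mix_iterate hc K st.s) (dispersion_mix_iterate_le hn hr hc K st.s)
    change trackingError loss y' s' ≤ 8 * a ^ 2 * trackingError loss st.y st.s + _ + _ at h1
    have h2 := mul_sum_sq_norm_sub_le h alg y'
    have h3 := mul_sum_sq_norm_sub_le h alg st.y
    have h4 := trackingError_nonneg loss st.y st.s
    have h5 : 0 ≤ L ^ 2 * dispersion st.y := mul_nonneg (sq_nonneg _) (dispersion_nonneg _)
    have e : (0.0008 * (trackingError loss st.y st.s / σ)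
      + 9 * (L ^ 2 / σ * dispersion st.y) + 0.0004 * (V y' + V st.y)) * σ =
        0.0008 * trackingError loss st.y st.s + 9 * (L ^ 2 * dispersion st.y)
          + 0.0004 * (σ * V y' + σ * V st.y) := by field_simp
    rw [div_le_iff₀ hσ, e]
    have h6 := mul_le_mul_of_nonneg_left h2 hσ.le
    have h7 := mul_le_mul_of_nonneg_left h3 hσ.le
    have h8 := mul_le_mul_of_nonneg_right ha2 h4
    have h9 := mul_le_mul_of_nonneg_right ha2 h5
    linarith
  have hx0 : 0 ≤ V st.x := totalPotential_nonneg h alg _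
  have hy0 : 0 ≤ V st.y := totalPotential_nonneg h alg _
  have hM0 : 0 ≤ L ^ 2 / σ * dispersion st.y := mul_nonneg (by positivity) (dispersion_nonneg _)
  have hG0 : 0 ≤ trackingError loss st.y st.s / σ :=
    div_nonneg (trackingError_nonneg _ _ _) hσ.le
  -- The left side is `1.2 V(y') + 1000 M' + 50 G'`, with `M`, `G` the scaled dispersion and
  -- tracking error and primes for the new values. By `hM`, `hVy`, `hG` it is at most about `1.42
  -- V(x) + 0.02 V(y) + 450 M + 0.04 G`, and half the Lyapunov function is `2 V(x) + 0.5 V(y) + 500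
  -- M + 5 G`.
  simp only [lyapunov, networkLyapunov, ← hV]
  linarith

theorem lyapunov_nonneg (h : IsRegular loss σ L o) (alg : Variant) (st : State n d) :
    0 ≤ lyapunov alg loss σ L o st := by
  have hσ := h.pos
  have h1 := totalPotential_nonneg h alg st.x
  have h2 := totalPotential_nonneg h alg st.y
  have h3 := dispersion_nonneg st.y
  have h4 := trackingError_nonneg loss st.y st.s
  simp only [lyapunov, networkLyapunov]
  positivity

theorem sq_errorMetric_le (h : IsRegular loss σ L o) (alg : Variant) (st : State n d) :
    errorMetric loss L o st ^ 2 ≤ 2 / σ * lyapunov alg loss σ L o st := by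
  have hσ := h.pos
  have hL : 0 < L := hσ.trans_le h.le
  have h1 := totalPotential_nonneg h alg st.x
  have h2 := totalPotential_nonneg h alg st.y
  have h3 := dispersion_nonneg st.y
  have h4 := trackingError_nonneg loss st.y st.s
  have hM0 : 0 ≤ L ^ 2 / σ * dispersion st.y := by positivity
  have hG0 : 0 ≤ trackingError loss st.y st.s / σ := by positivity
  have hψ : ∀ t, σ / 2 * t ≤ totalPotential alg loss σ o st.y + 1000 * (L ^ 2 / σ * dispersion st.y)
      + 10 * (trackingError loss st.y st.s / σ) → t ≤ 2 / σ * lyapunov alg loss σ L o st := by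
    intro t ht
    rw [div_mul_eq_mul_div, le_div_iff₀ hσ]
    simp only [lyapunov, networkLyapunov]
    linarith
  have hσL : σ ^ 2 ≤ L ^ 2 := pow_le_pow_left₀ hσ.le h.le 2
  rw [errorMetric]
  rcases max_choice (√(n : ℝ) * ‖average st.y - o‖) (max √(∑ j, ‖st.y j - average st.y‖ ^ 2)
      (L⁻¹ * √(∑ j, ‖st.s j - gradient (globalLoss loss) (st.y j)‖ ^ 2))) with hm | hm
  · rw [hm, mul_pow, Real.sq_sqrt (Nat.cast_nonneg n), ← average_sub_const h.agents_pos]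
    refine (mul_sq_norm_average_le h.agents_pos _).trans (hψ _ ?_)
    have := mul_sum_sq_norm_sub_le h alg st.y
    linarith
  · rw [hm]
    rcases max_choice √(∑ j, ‖st.y j - average st.y‖ ^ 2)
      (L⁻¹ * √(∑ j, ‖st.s j - gradient (globalLoss loss) (st.y j)‖ ^ 2)) with hm | hm
    · rw [hm]
      change √(dispersion st.y) ^ 2 ≤ _
      rw [Real.sq_sqrt h3]
      refine hψ _ ?_
      have : σ * dispersion st.y ≤ L ^ 2 / σ * dispersion st.y := by
        refine mul_le_mul_of_nonneg_right ?_ h3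
        rw [le_div_iff₀ hσ, ← sq]; exact hσL
      change σ / 2 * dispersion st.y ≤ _
      linarith
    · rw [hm]
      change (L⁻¹ * √(trackingError loss st.y st.s)) ^ 2 ≤ _
      rw [mul_pow, Real.sq_sqrt h4]
      refine hψ _ ?_
      have : σ * (L⁻¹ ^ 2 * trackingError loss st.y st.s) ≤ trackingError loss st.y st.s / σ := by
        rw [le_div_iff₀ hσ]
        have e : σ * (L⁻¹ ^ 2 * trackingError loss st.y st.s) * σ
          = (σ ^ 2 / L ^ 2) * trackingError loss st.y st.s := by field_simp
        rw [e]
        exact mul_le_of_le_one_left h4 (div_le_one_of_le₀ hσL (sq_nonneg _))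
      change σ / 2 * (L⁻¹ ^ 2 * trackingError loss st.y st.s) ≤ _
      linarith

end Lyapunov

/-! ### Expectation over the seeds -/

section Probability

variable {Ω : Type*} [MeasurableSpace Ω] {P : Measure Ω}

theorem integrable_comp_of_finite [IsFiniteMeasure P] {α : Type*} [Finite α] [MeasurableSpace α]
    [MeasurableSingletonClass α] {X : Ω → α} (hX : Measurable X) (φ : α → ℝ) :
    Integrable (fun ω => φ (X ω)) P :=
  (Integrable.of_finite (f := φ) (μ := P.map X)).comp_measurable hX

/-- Fubini on the product law: the fresh variable is integrated out against its point masses. -/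
theorem integral_comp_of_indepFun [IsProbabilityMeasure P] {α β : Type*} [Finite α]
    [MeasurableSpace α] [MeasurableSingletonClass α] [Fintype β] [MeasurableSpace β]
    [MeasurableSingletonClass β] {X : Ω → α} {Y : Ω → β} (hX : Measurable X) (hY : Measurable Y)
    (hXY : IndepFun X Y P) (φ : α → β → ℝ) :
    ∫ ω, φ (X ω) (Y ω) ∂P = ∫ ω, ∑ b, P.real {ω | Y ω = b} * φ (X ω) b ∂P := by
  have := Measure.isProbabilityMeasure_map (μ := P) hX.aemeasurable
  have := Measure.isProbabilityMeasure_map (μ := P) hY.aemeasurable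
  have h1 : ∫ ω, φ (X ω) (Y ω) ∂P
      = ∫ p, φ p.1 p.2 ∂(P.map fun ω => (X ω, Y ω)) := by
    rw [integral_map (hX.prodMk hY).aemeasurable
      (measurable_of_finite _).aestronglyMeasurable]
  rw [h1, (indepFun_iff_map_prod_eq_prod_map_map hX.aemeasurable hY.aemeasurable).1 hXY,
    integral_prod _ Integrable.of_finite, integral_map hX.aemeasurable
      (measurable_of_finite _).aestronglyMeasurable]
  congr 1
  funext ω
  rw [integral_fintype Integrable.of_finite]
  refine Finset.sum_congr rfl fun b _ => ?_
  rw [map_measureReal_apply hY (measurableSet_singleton b)]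
  rfl

variable {seed : ℕ × Fin n → Ω → Seed m S}

/-- The seeds of the first `t` iterations. -/
def pastSeeds (seed : ℕ × Fin n → Ω → Seed m S) (t : ℕ) (ω : Ω)
    (p : ↥(Finset.range t ×ˢ (Finset.univ : Finset (Fin n)))) : Seed m S := seed p ω

theorem IsUniformSampling.measurable_pastSeeds (hs : IsUniformSampling P seed) (t : ℕ) :
    Measurable (pastSeeds seed t) :=
  measurable_pi_lambda _ fun p => hs.measurable p

theorem IsUniformSampling.indepFun_pastSeeds (hs : IsUniformSampling P seed) (t : ℕ)
    (j : Fin n) : IndepFun (pastSeeds seed t) (seed (t, j)) P := by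
  have h1 := hs.indep.indepFun_finset (Finset.range t ×ˢ (Finset.univ : Finset (Fin n)))
    {(t, j)} (by simp) hs.measurable
  exact h1.comp measurable_id
    (measurable_pi_apply (⟨(t, j), Finset.mem_singleton_self _⟩ : ({(t, j)} : Finset (ℕ × Fin n))))

/-- The state after `t` iterations is a function of the seeds of these iterations. -/
theorem exists_run_eq {Ω : Type*} (hm : 0 < m) (hS : 0 < S) (alg : Variant) (W : Matrix (Fin n) (Fin n) ℝ)
    (K : ℕ) (δ : ℝ) (x₀ : Fin n → Vec d) (seed : ℕ × Fin n → Ω → Seed m S) (t : ℕ) :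
    ∃ R : (↥(Finset.range t ×ˢ (Finset.univ : Finset (Fin n))) → Seed m S) → State n d,
      ∀ ω, run alg loss W K δ x₀ (fun p => seed p ω) t = R (pastSeeds seed t ω) := by
  -- Seeds of later iterations are replaced by an arbitrary default, which exists as `m` and `S` are
  -- positive and is never read.
  refine ⟨fun x => run alg loss W K δ x₀ (fun p =>
    if hp : p ∈ Finset.range t ×ˢ (Finset.univ : Finset (Fin n)) then x ⟨p, hp⟩
    else (fun _ => ⟨0, hm⟩, ⟨0, hS⟩)) t, fun ω => run_congr _ _ _ _ _ fun p hp => ?_⟩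
  have hp' : p ∈ Finset.range t ×ˢ (Finset.univ : Finset (Fin n)) := by simpa using hp
  rw [dif_pos hp']
  rfl

/-- The state takes finitely many values, one for each past seed at most, so `φ` needs no
regularity. -/
theorem IsUniformSampling.integrable_run [IsProbabilityMeasure P]
    (hs : IsUniformSampling P seed) (hm : 0 < m) (hS : 0 < S)
    (alg : Variant) (W : Matrix (Fin n) (Fin n) ℝ) (K : ℕ) (δ : ℝ) (x₀ : Fin n → Vec d) (t : ℕ)
    (φ : State n d → ℝ) :
    Integrable (fun ω => φ (run alg loss W K δ x₀ (fun p => seed p ω) t)) P := by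
  obtain ⟨R, hR⟩ := exists_run_eq (loss := loss) hm hS alg W K δ x₀ seed t
  simp only [hR]
  exact integrable_comp_of_finite (hs.measurable_pastSeeds t) fun x => φ (R x)

/-- The expected potential after the inner loops. -/
theorem integral_potential_run_succ_le [IsProbabilityMeasure P] {o : Vec d}
    (h : IsRegular loss σ L o) (alg : Variant)
    (hs : IsUniformSampling P seed) (hS : 1000000 * (L / σ) ≤ S) (W : Matrix (Fin n) (Fin n) ℝ)
    (K : ℕ) (x₀ : Fin n → Vec d) (t : ℕ) (j : Fin n) :
    ∫ ω, potential alg σ (globalLoss loss) o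
        ((run alg loss W K (1 / 1000 / L) x₀ (fun p => seed p ω) (t + 1)).x j) ∂P
      ≤ ∫ ω, (fun st => 1 / 20 * potential alg σ (globalLoss loss) o (nextY W K st j)
          + 10 * (‖nextS loss W K st j - gradient (globalLoss loss) (nextY W K st j)‖ ^ 2 / σ))
          (run alg loss W K (1 / 1000 / L) x₀ (fun p => seed p ω) t) ∂P := by
  have hσ := h.pos
  have hL : 0 < L := hσ.trans_le h.le
  have hm := h.samples_pos
  have hS0' : (0 : ℝ) < S := lt_of_lt_of_le (by positivity) hS
  have hS0 : 0 < S := by exact_mod_cast hS0'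
  have hm' : (0 : ℝ) < m := by exact_mod_cast hm
  let φ : State n d → ℝ := fun st => ∑ b : Seed m S, ((m : ℝ) ^ S * S)⁻¹ *
    potential alg σ (globalLoss loss) o (innerLoop alg (loss j) (1 / 1000 / L) (nextY W K st j)
      (nextS loss W K st j) b.1 b.2.succ).1
  let ψ : State n d → ℝ := fun st => 1 / 20 * potential alg σ (globalLoss loss) o (nextY W K st j)
    + 10 * (‖nextS loss W K st j - gradient (globalLoss loss) (nextY W K st j)‖ ^ 2 / σ)
  refine le_trans (b := ∫ ω, φ (run alg loss W K (1 / 1000 / L) x₀ (fun p => seed p ω) t) ∂P) ?_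
    (integral_mono (hs.integrable_run hm hS0 alg W K _ x₀ t φ)
      (hs.integrable_run hm hS0 alg W K _ x₀ t ψ) fun ω => ?_)
  · obtain ⟨R, hR⟩ := exists_run_eq (loss := loss) hm hS0 alg W K (1 / 1000 / L) x₀ seed t
    simp only [run, iterate_eq, hR, φ]
    rw [integral_comp_of_indepFun (hs.measurable_pastSeeds t) (hs.measurable (t, j))
      (hs.indepFun_pastSeeds t j) fun x b => potential alg σ (globalLoss loss) o
        (innerLoop alg (loss j) (1 / 1000 / L) (nextY W K (R x) j) (nextS loss W K (R x) j)
          b.1 b.2.succ).1]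
    simp only [hs.uniform]
    exact le_rfl
  · simp only [φ]
    rw [← Finset.mul_sum, inv_mul_le_iff₀ (by positivity), Fintype.sum_prod_type_right]
    exact sum_potential_innerLoop_le alg hm hσ h.le h.convexSmooth j (h.localLoss j) h.globalLoss
      (h.similar j) h.minimizer hS _ _

theorem integral_lyapunov_run_succ_le [IsProbabilityMeasure P] {o : Vec d}
    (h : IsRegular loss σ L o) (alg : Variant)
    (hq : alg = .sarah → ∀ j, IsQuadratic (localLoss loss j))
    (hs : IsUniformSampling P seed) (hS : 1000000 * (L / σ) ≤ S) {W : Matrix (Fin n) (Fin n) ℝ}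
    (hr : ∀ i, ∑ j, W i j = 1) (hc : ∀ j, ∑ i, W i j = 1) {K : ℕ}
    (hK : mixingRate W ^ K ≤ 1 / 100 / (L / σ)) (x₀ : Fin n → Vec d) (t : ℕ) :
    ∫ ω, lyapunov alg loss σ L o
        (run alg loss W K (1 / 1000 / L) x₀ (fun p => seed p ω) (t + 1)) ∂P
      ≤ 1 / 2 * ∫ ω, lyapunov alg loss σ L o
        (run alg loss W K (1 / 1000 / L) x₀ (fun p => seed p ω) t) ∂P := by
  have hσ := h.pos
  have hL : 0 < L := hσ.trans_le h.le
  have hm := h.samples_pos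
  have hS0' : (0 : ℝ) < S := lt_of_lt_of_le (by positivity) hS
  have hS0 : 0 < S := by exact_mod_cast hS0'
  let X : ℕ → Ω → State n d := fun t ω => run alg loss W K (1 / 1000 / L) x₀ (fun p => seed p ω) t
  have hint : ∀ (t : ℕ) (φ : State n d → ℝ), Integrable (fun ω => φ (X t ω)) P := fun t φ =>
    hs.integrable_run hm hS0 alg W K _ x₀ t φ
  let ψ : Fin n → State n d → ℝ := fun j st =>
    1 / 20 * potential alg σ (globalLoss loss) o (nextY W K st j)
      + 10 * (‖nextS loss W K st j - gradient (globalLoss loss) (nextY W K st j)‖ ^ 2 / σ)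
  let N : State n d → ℝ := fun st =>
    networkLyapunov alg loss σ L o (nextY W K st) (nextS loss W K st)
  change ∫ ω, lyapunov alg loss σ L o (X (t + 1) ω) ∂P ≤
    1 / 2 * ∫ ω, lyapunov alg loss σ L o (X t ω) ∂P
  -- The new `y` and `s` are functions of the old state; only the new `x` carries fresh randomness.
  have hsplit : ∀ ω, lyapunov alg loss σ L o (X (t + 1) ω) =
      4 * (∑ j, potential alg σ (globalLoss loss) o ((X (t + 1) ω).x j)) + N (X t ω) := fun ω => by
    simp only [X, run, iterate_eq, lyapunov, totalPotential, N]
  calc ∫ ω, lyapunov alg loss σ L o (X (t + 1) ω) ∂P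
      = 4 * ∑ j, ∫ ω, potential alg σ (globalLoss loss) o ((X (t + 1) ω).x j) ∂P
        + ∫ ω, N (X t ω) ∂P := by
        simp only [hsplit]
        rw [integral_add, integral_const_mul, integral_finsetSum]
        · exact fun j _ => hint (t + 1) fun st => potential alg σ (globalLoss loss) o (st.x j)
        · exact hint (t + 1) fun st => 4 * ∑ j, potential alg σ (globalLoss loss) o (st.x j)
        · exact hint t N
    _ ≤ 4 * ∑ j, ∫ ω, ψ j (X t ω) ∂P + ∫ ω, N (X t ω) ∂P := by
        refine add_le_add (mul_le_mul_of_nonneg_left (Finset.sum_le_sum fun j _ => ?_)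
          (by norm_num)) le_rfl
        exact integral_potential_run_succ_le h alg hs hS W K x₀ t j
    _ = ∫ ω, (4 * ∑ j, ψ j (X t ω) + N (X t ω)) ∂P := by
        rw [integral_add, integral_const_mul, integral_finsetSum]
        · exact fun j _ => hint t (ψ j)
        · exact hint t fun st => 4 * ∑ j, ψ j st
        · exact hint t N
    _ ≤ ∫ ω, 1 / 2 * lyapunov alg loss σ L o (X t ω) ∂P := by
        refine integral_mono (hint t fun st => 4 * ∑ j, ψ j st + N st)
          (hint t fun st => 1 / 2 * lyapunov alg loss σ L o st) fun ω => ?_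
        have h1 := networkLyapunov_next_le h alg hq hr hc hK
          (isTracking_run alg hc K (1 / 1000 / L) x₀ (fun p => seed p ω) t)
        simp only [totalPotential, trackingError, Finset.sum_div, Finset.mul_sum] at h1
        simp only [ψ, N, Finset.sum_add_distrib] at h1 ⊢
        exact h1
    _ = _ := integral_const_mul _ _

theorem integral_lyapunov_run_le [IsProbabilityMeasure P] {o : Vec d}
    (h : IsRegular loss σ L o) (alg : Variant)
    (hq : alg = .sarah → ∀ j, IsQuadratic (localLoss loss j))
    (hs : IsUniformSampling P seed) (hS : 1000000 * (L / σ) ≤ S) {W : Matrix (Fin n) (Fin n) ℝ}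
    (hr : ∀ i, ∑ j, W i j = 1) (hc : ∀ j, ∑ i, W i j = 1) {K : ℕ}
    (hK : mixingRate W ^ K ≤ 1 / 100 / (L / σ)) (x₀ : Fin n → Vec d) (t : ℕ) :
    ∫ ω, lyapunov alg loss σ L o
        (run alg loss W K (1 / 1000 / L) x₀ (fun p => seed p ω) t) ∂P
      ≤ (1 / 2) ^ t * lyapunov alg loss σ L o (initialState loss x₀) := by
  induction t with
  | zero => simp [run]
  | succ t ih =>
    refine (integral_lyapunov_run_succ_le h alg hq hs hS hr hc hK x₀ t).trans ?_
    rw [pow_succ']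
    linarith

/-- Linear convergence in expectation. -/
theorem integral_errorAt_le [IsProbabilityMeasure P] {o : Vec d}
    (h : IsRegular loss σ L o) (alg : Variant)
    (hq : alg = .sarah → ∀ j, IsQuadratic (localLoss loss j))
    (hs : IsUniformSampling P seed) (hS : 1000000 * (L / σ) ≤ S) {W : Matrix (Fin n) (Fin n) ℝ}
    (hr : ∀ i, ∑ j, W i j = 1) (hc : ∀ j, ∑ i, W i j = 1) {K : ℕ}
    (hK : mixingRate W ^ K ≤ 1 / 100 / (L / σ)) (x₀ : Fin n → Vec d) (t : ℕ) :
    ∫ ω, errorAt alg loss W K (1 / 1000 / L) L o x₀ seed t ω ∂P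
      ≤ (2 / σ * lyapunov alg loss σ L o (initialState loss x₀) + 1) * (3 / 4) ^ t := by
  have hσ := h.pos
  have hL : 0 < L := hσ.trans_le h.le
  have hm := h.samples_pos
  have hS0' : (0 : ℝ) < S := lt_of_lt_of_le (by positivity) hS
  have hS0 : 0 < S := by exact_mod_cast hS0'
  set Ψ := lyapunov alg loss σ L o (initialState loss x₀) with hΨ
  have hΨ0 : 0 ≤ Ψ := lyapunov_nonneg h alg _
  set b : ℝ := (3 / 4) ^ t with hb
  have hb0 : 0 < b := by positivity
  have hint : ∀ φ : State n d → ℝ, Integrable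
      (fun ω => φ (run alg loss W K (1 / 1000 / L) x₀ (fun p => seed p ω) t)) P := fun φ =>
    hs.integrable_run hm hS0 alg W K _ x₀ t φ
  -- `1/2 ≤ (3/4)²`. Below, `e ≤ e²/b + b` passes from the second moment to the first, and with this
  -- `b` both terms are of order `b`.
  have hpow : (1 / 2 : ℝ) ^ t ≤ b * b := by
    rw [hb, ← mul_pow]
    exact pow_le_pow_left₀ (by norm_num) (by norm_num) t
  calc ∫ ω, errorAt alg loss W K (1 / 1000 / L) L o x₀ seed t ω ∂P
      ≤ ∫ ω, (2 / σ / b * lyapunov alg loss σ L o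
          (run alg loss W K (1 / 1000 / L) x₀ (fun p => seed p ω) t) + b) ∂P := by
        refine integral_mono (hint (errorMetric loss L o))
          (hint fun st => 2 / σ / b * lyapunov alg loss σ L o st + b) fun ω => ?_
        have h1 := sq_errorMetric_le h alg
          (run alg loss W K (1 / 1000 / L) x₀ (fun p => seed p ω) t)
        have h0 := lyapunov_nonneg h alg (run alg loss W K (1 / 1000 / L) x₀ (fun p => seed p ω) t)
        simp only [errorAt]
        set e := errorMetric loss L o (run alg loss W K (1 / 1000 / L) x₀ (fun p => seed p ω) t)
        set ψ := lyapunov alg loss σ L o (run alg loss W K (1 / 1000 / L) x₀ (fun p => seed p ω) t)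
        have e1 : 2 / σ / b * ψ + b = (2 / σ * ψ + b ^ 2) / b := by field_simp
        rw [e1, le_div_iff₀ hb0]
        nlinarith [sq_nonneg (e - b), sq_nonneg (e + b)]
    _ = 2 / σ / b * ∫ ω, lyapunov alg loss σ L o
          (run alg loss W K (1 / 1000 / L) x₀ (fun p => seed p ω) t) ∂P + b := by
        rw [integral_add (hint fun st => 2 / σ / b * lyapunov alg loss σ L o st)
          (integrable_const _), integral_const_mul]
        simp
    _ ≤ 2 / σ / b * (b * b * Ψ) + b := by
        refine add_le_add (mul_le_mul_of_nonneg_left ?_ (by positivity)) le_rfl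
        exact (integral_lyapunov_run_le h alg hq hs hS hr hc hK x₀ t).trans
          (mul_le_mul_of_nonneg_right hpow hΨ0)
    _ = _ := by field_simp

end Probability

end

/-! ### Standing assumptions and complexity count -/

variable {n m d : ℕ} {loss : Fin n → Fin m → Vec d → ℝ} {σ L : ℝ}

theorem isRegular (hn : 0 < n) (hm : 0 < m) (hσ : 0 < σ) (hσL : σ ≤ L)
    (hconv : ∀ j i, IsConvexSmooth L (loss j i))
    (hstrong : ∀ j, IsStronglyConvexSmooth σ L (localLoss loss j))
    (hβ : homogeneity loss / σ ≤ 1 / 200) {o : Vec d}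
    (ho : IsMinOn (globalLoss loss) Set.univ o) : IsRegular loss σ L o where
  agents_pos := hn
  samples_pos := hm
  pos := hσ
  le := hσL
  convexSmooth := hconv
  localLoss := isStronglyMonotoneSmooth_localLoss hm hconv hstrong
  similar j x y := by
    refine (norm_gradient_sub_sub_le_homogeneity (hσ.trans_le hσL).le hn
      (isStronglyMonotoneSmooth_localLoss hm hconv hstrong)
      (fun j => (hstrong j).differentiable_gradient) j x y).trans ?_
    refine mul_le_mul_of_nonneg_right ?_ (norm_nonneg _)
    rw [div_le_iff₀ hσ] at hβ
    linarith
  minimizer := gradient_eq_zero_of_isMinOn ho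

/-- The least number of mixing rounds that reaches the rate `c / κ` is not excessive. -/
theorem exists_mixing_rounds {α κ c c₁ : ℝ} (hα0 : 0 ≤ α) (hα1 : α < 1) (hc : 0 < c ∧ c ≤ 1)
    (hκ : 1 ≤ κ) (hc₁ : c₁ ≤ c) :
    ∃ K : ℕ, 1 ≤ K ∧ α ^ K ≤ c / κ ∧ c₁ / κ ≤ α ^ (K - 1) := by
  have hκ0 : 0 < κ := by linarith
  have hex : ∃ K : ℕ, α ^ (K + 1) ≤ c / κ := by
    obtain ⟨K, hK⟩ := exists_pow_lt_of_lt_one (div_pos hc.1 hκ0) hα1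
    exact ⟨K, (pow_le_pow_of_le_one hα0 hα1.le K.le_succ).trans hK.le⟩
  classical
  refine ⟨Nat.find hex + 1, by omega, Nat.find_spec hex, ?_⟩
  rw [Nat.add_sub_cancel]
  have hcκ : c₁ / κ ≤ c / κ := div_le_div_of_nonneg_right hc₁ hκ0.le
  -- If one round suffices, the preceding power is `1`; otherwise minimality says that one round
  -- fewer fails.
  rcases Nat.eq_zero_or_pos (Nat.find hex) with h0 | h0
  · rw [h0, pow_zero, div_le_one hκ0]
    linarith [hc.2]
  · have h1 := Nat.find_min hex (Nat.sub_lt h0 one_pos)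
    rw [show Nat.find hex - 1 + 1 = Nat.find hex from Nat.sub_add_cancel h0, not_le] at h1
    exact hcκ.trans h1.le

/-- A bound on the number of mixing rounds that are not excessive. -/
theorem mul_one_sub_le_of_div_le_pow {α κ c₁ : ℝ} (hα0 : 0 ≤ α) (hc₁ : 0 < c₁)
    (hκ : 1 ≤ κ) {K : ℕ} (hK : 1 ≤ K) (h : c₁ / κ ≤ α ^ (K - 1)) :
    K * (1 - α) ≤ (1 + |Real.log c₁|) * (1 + Real.log κ) := by
  have hκ0 : 0 < κ := by linarith
  -- This turns the hypothesis into `(K - 1)(1 - α) ≤ log κ - log c₁`; the remaining round costs at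
  -- most `1`.
  have h1 : α ≤ Real.exp (-(1 - α)) := by
    have := Real.add_one_le_exp (-(1 - α))
    linarith
  have h2 : c₁ / κ ≤ Real.exp ((K - 1 : ℕ) * -(1 - α)) := by
    rw [Real.exp_nat_mul]
    exact h.trans (pow_le_pow_left₀ hα0 h1 _)
  have h3 := Real.log_le_log (div_pos hc₁ hκ0) h2
  rw [Real.log_exp, Real.log_div hc₁.ne' hκ0.ne', Nat.cast_sub hK, Nat.cast_one] at h3
  have h4 := neg_abs_le (Real.log c₁)
  have h5 : 0 ≤ Real.log κ := Real.log_nonneg hκ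
  have h6 := mul_nonneg (abs_nonneg (Real.log c₁)) h5
  linarith

/-- After `8 log(1/ε)` iterations the geometric factor is at most `ε²`. One `ε` absorbs `C`, so the
data-dependent constant restricts `ε` but not the iteration count. -/
theorem mul_pow_le_of_log_le {C ε : ℝ} (hC : 0 < C) (hε : 0 < ε) (hεC : ε ≤ C⁻¹) {t : ℕ}
    (ht : 8 * Real.log (1 / ε) ≤ t) : C * (3 / 4) ^ t ≤ ε := by
  have h1 : (3 / 4 : ℝ) ≤ Real.exp (-(1 / 4)) := by
    have := Real.add_one_le_exp (-(1 / 4 : ℝ))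
    linarith
  have h2 : (3 / 4 : ℝ) ^ t ≤ ε * ε := by
    calc (3 / 4 : ℝ) ^ t ≤ Real.exp (-(1 / 4)) ^ t := pow_le_pow_left₀ (by norm_num) h1 t
      _ = Real.exp (t * -(1 / 4)) := (Real.exp_nat_mul _ _).symm
      _ ≤ Real.exp (Real.log ε + Real.log ε) := by
          refine Real.exp_le_exp.2 ?_
          rw [one_div, Real.log_inv] at ht
          linarith
      _ = ε * ε := by rw [Real.exp_add, Real.exp_log hε]
  have h3 : C * ε ≤ 1 := by
    have := mul_le_mul_of_nonneg_left hεC hC.le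
    rwa [mul_inv_cancel₀ hC.ne'] at this
  calc C * (3 / 4) ^ t ≤ C * (ε * ε) := mul_le_mul_of_nonneg_left h2 hC.le
    _ = C * ε * ε := by ring
    _ ≤ 1 * ε := mul_le_mul_of_nonneg_right h3 hε.le
    _ = ε := one_mul ε

end NetVR

end

theorem theorem5 :
    -- absolute constants
    ∃ ρ c η cS A : ℝ, 0 < ρ ∧ ρ < 1 ∧ 0 < c ∧ c < 1 ∧ 0 < η ∧ 0 < cS ∧ 0 < A ∧
    ∀ c₁ : ℝ, 0 < c₁ → ∃ B : ℝ, 0 < B ∧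
    -- the problem and the network
    ∀ (n m d : ℕ), 0 < n → 0 < m →
    ∀ (loss : Fin n → Fin m → NetVR.Vec d → ℝ) (G : SimpleGraph (Fin n))
      (W : Matrix (Fin n) (Fin n) ℝ) (σ L : ℝ),
    NetVR.IsMixingMatrix G W →
    0 < σ → σ ≤ L →
    (∀ j i, NetVR.IsConvexSmooth L (loss j i)) →
    (∀ j, NetVR.IsStronglyConvexSmooth σ L (NetVR.localLoss loss j)) →
    NetVR.homogeneity loss / σ ≤ 1 / 200 →
    -- admissible numbers of mixing rounds exist
    (c₁ ≤ c → ∃ K : ℕ, 1 ≤ K ∧ NetVR.mixingRate W ^ K ≤ c / (L / σ) ∧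
      c₁ / (L / σ) ≤ NetVR.mixingRate W ^ (K - 1)) ∧
    -- the algorithms
    ∀ alg : NetVR.Variant,
    (alg = NetVR.Variant.sarah → ∀ j, NetVR.IsQuadratic (NetVR.localLoss loss j)) →
    ∀ yopt : NetVR.Vec d, IsMinOn (NetVR.globalLoss loss) Set.univ yopt →
    ∀ (x₀ : Fin n → NetVR.Vec d) (K S : ℕ),
    1 ≤ K → NetVR.mixingRate W ^ K ≤ c / (L / σ) → cS * (L / σ) ≤ (S : ℝ) →
    ∃ C ε₀ : ℝ, 0 < C ∧ 0 < ε₀ ∧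
    ∀ {Ω : Type*} [MeasurableSpace Ω] (P : MeasureTheory.Measure Ω)
      [MeasureTheory.IsProbabilityMeasure P] (seed : ℕ × Fin n → Ω → NetVR.Seed m S),
    NetVR.IsUniformSampling P seed →
      (∀ t : ℕ, MeasureTheory.Integrable
        (NetVR.errorAt alg loss W K (η / L) L yopt x₀ seed t) P) ∧
      -- linear convergence in expectation, at the absolute rate `ρ`
      (∀ t : ℕ, 1 ≤ t →
        ∫ ω, NetVR.errorAt alg loss W K (η / L) L yopt x₀ seed t ω ∂P ≤ C * ρ ^ t) ∧
      -- iteration and communication complexity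
      (∀ ε : ℝ, 0 < ε → ε ≤ ε₀ → ∃ T : ℕ,
        (T : ℝ) ≤ A * Real.log (1 / ε) ∧
        (∀ t : ℕ, T ≤ t →
          ∫ ω, NetVR.errorAt alg loss W K (η / L) L yopt x₀ seed t ω ∂P ≤ ε) ∧
        (c₁ / (L / σ) ≤ NetVR.mixingRate W ^ (K - 1) → ∀ ω,
          ((NetVR.run alg loss W K (η / L) x₀ (fun p => seed p ω) T).rounds : ℝ) ≤
            B * ((1 + Real.log (L / σ)) * Real.log (1 / ε) / (1 - NetVR.mixingRate W)))) := by
  -- `A = 9` is the `8` of `mul_pow_le_of_log_le` plus `1` for rounding up; `B` multiplies it by the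
  -- factor from `mul_one_sub_le_of_div_le_pow`.
  refine ⟨3 / 4, 1 / 100, 1 / 1000, 1000000, 9, by norm_num, by norm_num, by norm_num, by norm_num,
    by norm_num, by norm_num, by norm_num, fun c₁ hc₁ => ⟨9 * (1 + |Real.log c₁|), by positivity, ?_⟩⟩
  intro n m d hn hm loss G W σ L hW hσ hσL hconv hstrong hβ
  have hL : 0 < L := hσ.trans_le hσL
  have hκ : 1 ≤ L / σ := (one_le_div hσ).2 hσL
  have hα0 : 0 ≤ NetVR.mixingRate W := norm_nonneg _
  refine ⟨NetVR.exists_mixing_rounds hα0 hW.rate_lt_one (by norm_num) hκ, ?_⟩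
  intro alg hq yopt hopt x₀ K S hK1 hK hS
  have hreg := NetVR.isRegular hn hm hσ hσL hconv hstrong hβ hopt
  have hm' : (0 : ℝ) < m := by exact_mod_cast hm
  have hS0 : 0 < S := by
    have : (0 : ℝ) < S := lt_of_lt_of_le (by positivity) hS
    exact_mod_cast this
  set C := 2 / σ * NetVR.lyapunov alg loss σ L yopt (NetVR.initialState loss x₀) + 1 with hC
  have hC0 : 0 < C := by
    have := NetVR.lyapunov_nonneg hreg alg (NetVR.initialState loss x₀)
    positivity
  -- `ε ≤ e⁻¹` gives `log(1/ε) ≥ 1`, which absorbs the rounding of `T`; `ε ≤ C⁻¹` absorbs `C`.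
  refine ⟨C, min (Real.exp (-1)) C⁻¹, hC0, lt_min (Real.exp_pos _) (inv_pos.2 hC0), ?_⟩
  intro Ω _ P _ seed hs
  have hlin : ∀ t, ∫ ω, NetVR.errorAt alg loss W K (1 / 1000 / L) L yopt x₀ seed t ω ∂P
      ≤ C * (3 / 4) ^ t := fun t =>
    NetVR.integral_errorAt_le hreg alg hq hs hS hW.row_sum hW.col_sum hK x₀ t
  refine ⟨fun t => hs.integrable_run hm hS0 alg W K _ x₀ t _, fun t _ => hlin t, ?_⟩
  intro ε hε hε₀
  have hlog : 1 ≤ Real.log (1 / ε) := by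
    rw [one_div, Real.log_inv]
    have := Real.log_le_log hε (hε₀.trans (min_le_left _ _))
    rw [Real.log_exp] at this
    linarith
  have hT : (⌈8 * Real.log (1 / ε)⌉₊ : ℝ) ≤ 9 * Real.log (1 / ε) := by
    have := Nat.ceil_lt_add_one (by positivity : 0 ≤ 8 * Real.log (1 / ε))
    linarith
  refine ⟨⌈8 * Real.log (1 / ε)⌉₊, hT, fun t ht => (hlin t).trans ?_, fun hK' ω => ?_⟩
  · exact NetVR.mul_pow_le_of_log_le hC0 hε (hε₀.trans (min_le_right _ _)) (Nat.ceil_le.1 ht)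
  · rw [NetVR.run_rounds]
    push_cast
    have h1 := NetVR.mul_one_sub_le_of_div_le_pow hα0 hc₁ hκ hK1 hK'
    have h2 : 0 < 1 - NetVR.mixingRate W := by linarith [hW.rate_lt_one]
    have h3 := mul_le_mul hT h1 (by positivity) (by positivity)
    rw [← mul_div_assoc, le_div_iff₀ h2]
    linarith
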